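/- **Setting.** Let $X$ be a finite set of actions, and let $\mathbb H_k,\mathbb H_{\tilde k}$ be real reproducing kernel Hilbert spaces of functions on $X$ with $k(x,x)\le 1$, $\tilde k(x,x)\le 1$. For a horizon $T\ge 1$ let $f_1,\dots,f_T\in\mathbb H_k$ (rewards) and $g_1,\dots,g_T\in\mathbb H_{\tilde k}$ (constraints) satisfy $\|f_t\|\le B$, $\|g_t\|\le G$ with $B,G>0$; $\sum_{t=1}^{T-1}\|f_{t+1}-f_t\|\le B_f$, $\sum_{t=1}^{T-1}\|g_{t+1}-g_t\|\le B_g$; and, for some $\tau>0$, for every $t$ there is a probability distribution $\pi$ on $X$ with $\mathbb E_\pi g_t\le-\tau$. Put $B_\Delta=\max\{B_f,B_g\}>0$. Playing $x_t$ reveals $r_t=f_t(x_t)+n_t$ and $c_t=g_t(x_t)+\epsilon_t$, where $n_t$ and $\epsilon_t$ are conditionally $R$-sub-Gaussian given the past. For $\lambda>0$ let $\gamma_m=\max\frac12\log\det(I+\lambda^{-1}K_A)$ over all lists $A$ of $m$ points of $X$ (repetitions allowed), where $K_A$ is the kernel matrix of $k$; define $\tilde\gamma_m$ in the same way for $\tilde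 k$, and $\hat\gamma_m=\max\{\gamma_m,\tilde\gamma_m\}$. Let $\pi_t^*$ maximize $\mathbb E_\pi f_t$ over the distributions $\pi$ on $X$ with $\mathbb E_\pi g_t\le0$, and $$R(T)=\sum_{t=1}^T\mathbb E_{\pi_t^*}f_t-\sum_{t=1}^Tf_t(x_t),\qquad V(T)=\Big[\sum_{t=1}^Tg_t(x_t)\Big]_+ .$$ **Algorithm** (inputs $\lambda$, $\delta\in(0,1)$, integer restart period $N\ge1$, $\rho\ge 4B/\tau$, $\eta=\rho/(G\sqrt T)$). Let $\phi_1=0$. At time $t$ let $t_0$ be the first slot of the block of $N$ consecutive slots containing $t$ (the blocks start at $1,N+1,2N+1,\dots$). From the data of the slots $t_0,\dots,t-1$ compute the Gaussian process posterior mean $\mu$ and variance $\sigma^2$ with kernel $k$, noise variance $\lambda$ and observations $r$, and likewise $\tilde\mu,\tilde\sigma^2$ with $\tilde k$ and $c$. With $\beta=B+\frac{R}{\sqrt\lambda}\sqrt{2\log\frac1\delta+2\gamma_{t-t_0}}$ and $\tilde\beta=G+\frac{R}{\sqrt\lambda}\sqrt{2\log\frac1\delta+2\tilde\gamma_{t-t_0}}$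 let $\hat f_t$ be the projection of $\mu+\beta\sigma$ onto $[-B,B]$ and $\hat g_t$ the projection of $\tilde\mu-\tilde\beta\tilde\sigma$ onto $[-G,G]$. Play a maximizer $x_t$ of $\hat f_t-\phi_t\hat g_t$ over $X$ (ties broken arbitrarily, without knowledge of future noise), and set $\phi_{t+1}=\mathrm{Proj}_{[0,\rho]}[\phi_t+\eta\,\hat g_t(x_t)]$. **Statement.** Let $W=\hat\gamma_T^{1/4}T^{1/2}B_\Delta^{-1/2}$, suppose $W\le T$, and run the algorithm with restart period $N=\lceil W\rceil$. There is an absolute constant $C_0$, and for all $B,G,\lambda,c,q>0$ and $R\ge0$ there is a constant $C$ depending only on $B,G,R,\lambda,c,q$, such that whenever $\hat\gamma_1\ge c$ and $q/T\le\delta<1$, with probability at least $1-2\lceil T/N\rceil\delta$ both $$R(T)\le C_0\,\rho G\sqrt T+C\,\rho\,\hat\gamma_T^{7/8}B_\Delta^{1/4}T^{3/4},$$ $$V(T)\le C\Big(1+\frac1\rho\Big)\hat\gamma_T^{7/8}B_\Delta^{1/4}T^{3/4}+C_0\,G\sqrt T .$$ In particular, for fixed $p\in(0,1)$ the choice $\delta=p/(2\lceil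 T/N\rceil)$ gives both bounds with probability at least $1-p$ for all $T$, with $C$ depending only on $B,G,R,\lambda,c,p$. -/

import Mathlib

open MeasureTheory

noncomputable section

/-- The scalar kernel `k(x, y)` of a real reproducing kernel Hilbert space `H` of functions on `X`
(Mathlib's kernel is operator-valued; for scalar functions it is multiplication by `k(x, y)`). -/
def scalarKernel {X : Type*} (H : Type*) [NormedAddCommGroup H] [InnerProductSpace ℝ H]
    [CompleteSpace H] [RKHS ℝ H X ℝ] (x y : X) : ℝ :=
  RKHS.kernel H x y (1 : ℝ)

/-- The kernel matrix of a finite list of sampling points (repetitions allowed). -/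
def gramMatrix {X : Type*} (k : X → X → ℝ) {m : ℕ} (a : Fin m → X) :
    Matrix (Fin m) (Fin m) ℝ :=
  Matrix.of fun i j => k (a i) (a j)

/-- The maximum information gain `γ_m = max (1/2) log det (I + λ⁻¹ K_A)` over all lists `A` of `m`
sampling points. The domain is finite, so the supremum is over a finite set. -/
def infoGain {X : Type*} (k : X → X → ℝ) (lam : ℝ) (m : ℕ) : ℝ :=
  ⨆ a : Fin m → X, (1 / 2) * Real.log ((1 + lam⁻¹ • gramMatrix k a).det)

/-- The combined maximum information gain of two kernels. -/
def combinedGain {X : Type*} (k k' : X → X → ℝ) (lam : ℝ) (m : ℕ) : ℝ :=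
  max (infoGain k lam m) (infoGain k' lam m)

/-- The restart period `γ^{1/4} T^{1/2} b^{-1/2}` as a real number, for information gain `γ`,
horizon `T` and variation budget `b > 0`. -/
def restartPeriod (γ : ℝ) (T : ℕ) (b : ℝ) : ℝ :=
  γ ^ (1 / 4 : ℝ) * (T : ℝ) ^ (1 / 2 : ℝ) * b ^ (-(1 / 2) : ℝ)

/-- Posterior mean at `z` from the data `(a i, y i)`, `i < m`. -/
def postMean {X : Type*} (k : X → X → ℝ) (lam : ℝ) {m : ℕ} (a : Fin m → X) (y : Fin m → ℝ)
    (z : X) : ℝ :=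
  (fun i => k (a i) z) ⬝ᵥ Matrix.mulVec (gramMatrix k a + lam • 1)⁻¹ y

/-- Posterior variance at `z` from the sampling points `a i`, `i < m`. -/
def postVar {X : Type*} (k : X → X → ℝ) (lam : ℝ) {m : ℕ} (a : Fin m → X) (z : X) : ℝ :=
  k z z - (fun i => k (a i) z) ⬝ᵥ
    Matrix.mulVec (gramMatrix k a + lam • 1)⁻¹ (fun i => k (a i) z)

/-- Projection of a real number onto the interval `[a, b]`. -/
def clip (a b v : ℝ) : ℝ := max a (min b v)

/-- Tuning parameters: regularization `lam`, sub-Gaussian parameter `R`, confidence parameter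
`delta`, restart period `W`, dual bound `rho` and dual step size `eta`. -/
structure RestartParams where
  lam : ℝ
  R : ℝ
  delta : ℝ
  W : ℕ
  rho : ℝ
  eta : ℝ

namespace RestartParams

variable (p : RestartParams)

/-- The first slot `t₀` of the restart window containing slot `t ≥ 1`. The windows are
`1, …, W`, then `W + 1, …, 2 W`, and so on. -/
def start (t : ℕ) : ℕ := ((t - 1) / p.W) * p.W + 1

/-- Number of observations available in the current window just before slot `t`
(those of the slots `t₀, …, t - 1`). -/
def age (t : ℕ) : ℕ := t - p.start t

/-- Confidence width used at slot `t` for a function whose RKHS norm is at most `b`. -/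
def width {X : Type*} (k : X → X → ℝ) (b : ℝ) (t : ℕ) : ℝ :=
  b + 1 / √p.lam * p.R * √(2 * Real.log (1 / p.delta) + 2 * infoGain k p.lam (p.age t))

/-- Posterior mean at slot `t` from the points and observations of slots `t₀, …, t - 1`. -/
def mean {X : Type*} (k : X → X → ℝ) (x : ℕ → X) (y : ℕ → ℝ) (t : ℕ) (z : X) : ℝ :=
  postMean k p.lam (fun i : Fin (p.age t) => x (p.start t + i))
    (fun i : Fin (p.age t) => y (p.start t + i)) z

/-- Posterior standard deviation at slot `t` from the points of slots `t₀, …, t - 1`. -/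
def sd {X : Type*} (k : X → X → ℝ) (x : ℕ → X) (t : ℕ) (z : X) : ℝ :=
  √(postVar k p.lam (fun i : Fin (p.age t) => x (p.start t + i)) z)

/-- Truncated upper confidence bound (optimistic reward estimate). -/
def ucb {X : Type*} (k : X → X → ℝ) (b : ℝ) (x : ℕ → X) (y : ℕ → ℝ) (t : ℕ) (z : X) : ℝ :=
  clip (-b) b (p.mean k x y t z + p.width k b t * p.sd k x t z)

/-- Truncated lower confidence bound (optimistic constraint estimate). -/
def lcb {X : Type*} (k : X → X → ℝ) (b : ℝ) (x : ℕ → X) (y : ℕ → ℝ) (t : ℕ) (z : X) : ℝ :=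
  clip (-b) b (p.mean k x y t z - p.width k b t * p.sd k x t z)

/-- The dual variable: `φ₁ = 0` and `φ_{t+1} = Proj_{[0, ρ]} (φ_t + η ĝ_t(x_t))` for `t ≥ 1`.
It is not reset by a restart. The value at index `0` is not used. -/
def dual {X : Type*} (k' : X → X → ℝ) (G : ℝ) (x : ℕ → X) (c : ℕ → ℝ) : ℕ → ℝ
  | 0 => 0
  | 1 => 0
  | t + 2 => clip 0 p.rho
      (dual k' G x c (t + 1) + p.eta * p.lcb k' G x c (t + 1) (x (t + 1)))

/-- The acquisition function `f̂_t(z) - φ_t ĝ_t(z)`. -/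
def acquisition {X : Type*} (k k' : X → X → ℝ) (B G : ℝ) (x : ℕ → X) (r c : ℕ → ℝ)
    (t : ℕ) (z : X) : ℝ :=
  p.ucb k B x r t z - p.dual k' G x c t * p.lcb k' G x c t z

/-- The points `x`, rewards `r` and constraint observations `c` form a trajectory of the restarted
primal-dual algorithm up to time `T`: each `x t` maximizes the acquisition function, which depends
on the data of the slots before `t` only. Ties may be broken arbitrarily. -/
def IsTrajectory {X : Type*} (k k' : X → X → ℝ) (B G : ℝ) (T : ℕ) (x : ℕ → X)
    (r c : ℕ → ℝ) : Prop :=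
  ∀ t ∈ Finset.Icc 1 T, ∀ z : X,
    p.acquisition k k' B G x r c t z ≤ p.acquisition k k' B G x r c t (x t)

end RestartParams

/-- Expectation of `f` under the distribution (randomized policy) `π` on the finite set `X`. -/
def policyMean {X : Type*} [Fintype X] (π : X → ℝ) (f : X → ℝ) : ℝ := ∑ x, π x * f x

/-- `π` is a best policy for reward `f` under the constraint `g`: a probability distribution with
`E_π g ≤ 0` whose expected reward is largest among such distributions. -/
def IsBestPolicy {X : Type*} [Fintype X] (f g : X → ℝ) (π : X → ℝ) : Prop :=
  (π ∈ stdSimplex ℝ X ∧ policyMean π g ≤ 0) ∧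
    ∀ π' ∈ stdSimplex ℝ X, policyMean π' g ≤ 0 → policyMean π' f ≤ policyMean π f

/-- Dynamic regret of the points `x` against the policies `πs`. -/
def dynRegret {X : Type*} [Fintype X] (f : ℕ → X → ℝ) (πs : ℕ → X → ℝ) (T : ℕ)
    (x : ℕ → X) : ℝ :=
  ∑ t ∈ Finset.Icc 1 T, policyMean (πs t) (f t) - ∑ t ∈ Finset.Icc 1 T, f t (x t)

/-- Cumulative constraint violation of the points `x`. -/
def violation {X : Type*} (g : ℕ → X → ℝ) (T : ℕ) (x : ℕ → X) : ℝ :=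
  max (∑ t ∈ Finset.Icc 1 T, g t (x t)) 0

/-- `Z` is conditionally `R`-sub-Gaussian given the sigma-algebra `m`. -/
def CondSubGaussian {Ω : Type*} (m : MeasurableSpace Ω) {_mΩ : MeasurableSpace Ω}
    (P : Measure Ω) (R : ℝ) (Z : Ω → ℝ) : Prop :=
  ∀ s : ℝ, Integrable (fun ω => Real.exp (s * Z ω)) P ∧
    P[fun ω => Real.exp (s * Z ω) | m] ≤ᵐ[P] fun _ => Real.exp (s ^ 2 * R ^ 2 / 2)

/-- A noise sequence up to time `T`: `Z t` is revealed at time `t` and is conditionally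
`R`-sub-Gaussian given what is known before. Independent centred Gaussian noise with variance at
most `R ^ 2` is a special case. -/
def IsNoise {Ω : Type*} {mΩ : MeasurableSpace Ω} (ℱ : Filtration ℕ mΩ) (P : Measure Ω)
    (R : ℝ) (T : ℕ) (Z : ℕ → Ω → ℝ) : Prop :=
  ∀ t ∈ Finset.Icc 1 T, Measurable[ℱ t] (Z t) ∧ CondSubGaussian (ℱ (t - 1)) P R (Z t)

end

/-!
The argument separates a probabilistic part (the confidence bounds hold up to the drift inside a
restart window) from a deterministic analysis of the primal-dual iteration.

*Confidence bounds.* Write the kernel as an inner product of feature vectors, and let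
`α = (K + λ I)⁻¹ k(z)` be the weights of the posterior mean at `z`. The posterior variance equals
`‖φ z - ∑ αᵢ φ(aᵢ)‖² + λ |α|²` (`postVar_eq_norm_sq`). This identity controls the three parts of
the error of the posterior mean at slot `t`: a fixed function `f t` is reproduced up to
`‖f t‖ σ(z)`; the drift `f s - f t` of the earlier functions enters with weights of norm at most
`λ^{-1/2}`, so costs at most `√(age / λ)` times the variation inside the window; and the noise `y`
contributes at most `λ^{-1/2} σ(z)` times the self-normalized norm `√(yᵀ K (K + λ I)⁻¹ y)`
(`postMean_sq_le`). One more sampling point changes the squared self-normalized norm by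
`(2 a y + u y² - a²) / (1 + u)` and the determinant of `I + λ⁻¹ K` by the factor `1 + u`, where
`a` is the posterior mean of the noise and `λ u` the posterior variance at the new point. The
quantity `exp (q / (2 R²) - (log det) / 2)` is therefore a supermartingale: each step is a mixture of
the sub-Gaussian exponentials over a Gaussian with mean `a` and variance `u`
(`lintegral_mul_mixture_le`). Ville's inequality gives failure probability `δ` for each window and
each of the two kernels, uniformly over the slots of the window.

*Primal-dual analysis.* With optimistic estimates, the maximizer of the estimated Lagrangian is
compared with the best policy, and the telescoping of `φ²` gives the regret bound
(`PrimalDualRun.regret_le`). For the violation, `φ / η` dominates the accumulated estimated violation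
as long as `φ` is not cut off at `ρ`. When it is cut off, `φ ≥ ρ / 2 ≥ 2 B / τ` (for `T ≥ 4`), and
comparison with the Slater policy shows that the estimated constraint at the action is at most the
optimism error, so the cut costs no more than that error (`PrimalDualRun.sum_constraint_le`). No
bound on the variation of the optimal multipliers is needed.

*Orders of growth.* The drift errors sum to at most `λ^{-1/2} W^{3/2} b`. The posterior variances of a
window sum to at most `2 (1 + λ) γ_T`, so the confidence widths sum to the order `T γ_T W^{-1/2}`,
once `log (1 / δ)` is of order `γ_T`. This last fact comes from repeated sampling of one point, whose
information gain grows like `log T` because `γ₁ ≥ c`. The chosen `W` makes both sums of the order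
`γ_T^{7/8} b^{1/4} T^{3/4}`.
-/


/-! ### Posterior mean and variance in feature space -/

/-- The regularized kernel matrix `K_A + λ I`. -/
noncomputable def regGram {X : Type*} (k : X → X → ℝ) (lam : ℝ) {m : ℕ} (a : Fin m → X) :
    Matrix (Fin m) (Fin m) ℝ :=
  gramMatrix k a + lam • 1

/-- The weights `α = (K_A + λ I)⁻¹ k_A(z)` which the posterior mean at `z` gives to the
observations. -/
noncomputable def postWeights {X : Type*} (k : X → X → ℝ) (lam : ℝ) {m : ℕ}
    (a : Fin m → X) (z : X) : Fin m → ℝ :=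
  Matrix.mulVec (regGram k lam a)⁻¹ (fun i => k (a i) z)

/-- The squared self-normalized norm `yᵀ K_A (K_A + λ I)⁻¹ y` of a noise vector `y`, written as
`|y|² - λ yᵀ (K_A + λ I)⁻¹ y`. In feature space it is `‖Φᵀ y‖²` in the norm of `(ΦᵀΦ + λ I)⁻¹`. -/
noncomputable def selfNormalizedSq {X : Type*} (k : X → X → ℝ) (lam : ℝ) {m : ℕ}
    (a : Fin m → X) (y : Fin m → ℝ) : ℝ :=
  y ⬝ᵥ y - lam * (y ⬝ᵥ Matrix.mulVec (regGram k lam a)⁻¹ y)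

section Algebra

variable {X E : Type*} [NormedAddCommGroup E] [InnerProductSpace ℝ E]
variable {φ : X → E} {k : X → X → ℝ} {lam : ℝ} {m : ℕ}

theorem inner_sum_smul_feature (hk : ∀ x y, k x y = inner ℝ (φ x) (φ y)) (a : Fin m → X)
    (w : Fin m → ℝ) (z : X) :
    inner ℝ (φ z) (∑ i, w i • φ (a i)) = (fun i => k (a i) z) ⬝ᵥ w := by
  simp only [inner_sum, inner_smul_right, dotProduct, hk]
  exact Finset.sum_congr rfl fun i _ => by rw [real_inner_comm, mul_comm]

theorem inner_feature_sum_smul (hk : ∀ x y, k x y = inner ℝ (φ x) (φ y)) (a : Fin m → X)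
    (w : Fin m → ℝ) (i : Fin m) :
    inner ℝ (φ (a i)) (∑ j, w j • φ (a j)) = Matrix.mulVec (gramMatrix k a) w i := by
  rw [inner_sum_smul_feature hk]
  simp only [Matrix.mulVec, gramMatrix, dotProduct, Matrix.of_apply]
  exact Finset.sum_congr rfl fun j _ => by rw [hk, hk, real_inner_comm]

theorem inner_sum_smul_sum_smul (hk : ∀ x y, k x y = inner ℝ (φ x) (φ y)) (a : Fin m → X)
    (v w : Fin m → ℝ) :
    inner ℝ (∑ i, v i • φ (a i)) (∑ j, w j • φ (a j)) = v ⬝ᵥ Matrix.mulVec (gramMatrix k a) w := by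
  rw [sum_inner]
  simp only [inner_smul_left, inner_feature_sum_smul hk]
  rfl

theorem regGram_mulVec (a : Fin m → X) (w : Fin m → ℝ) :
    Matrix.mulVec (regGram k lam a) w = Matrix.mulVec (gramMatrix k a) w + lam • w := by
  simp [regGram, Matrix.add_mulVec, Matrix.smul_mulVec]

theorem det_regGram_pos (hk : ∀ x y, k x y = inner ℝ (φ x) (φ y)) (hlam : 0 < lam)
    (a : Fin m → X) : 0 < (regGram k lam a).det := by
  have h1 : (gramMatrix k a).PosSemidef := by
    have : gramMatrix k a = Matrix.gram ℝ (fun i => φ (a i)) := by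
      ext i j; simp [gramMatrix, hk, Matrix.gram_apply]
    rw [this]; exact Matrix.posSemidef_gram _ _
  exact (Matrix.PosDef.posSemidef_add h1 (Matrix.PosDef.one.smul hlam)).det_pos

theorem regGram_mulVec_inv (hk : ∀ x y, k x y = inner ℝ (φ x) (φ y)) (hlam : 0 < lam)
    (a : Fin m → X) (w : Fin m → ℝ) :
    Matrix.mulVec (regGram k lam a) (Matrix.mulVec (regGram k lam a)⁻¹ w) = w := by
  rw [Matrix.mulVec_mulVec, Matrix.mul_nonsing_inv _ (det_regGram_pos hk hlam a).ne'.isUnit,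
    Matrix.one_mulVec]

theorem regGram_inv_mulVec_eq (hk : ∀ x y, k x y = inner ℝ (φ x) (φ y)) (hlam : 0 < lam)
    (a : Fin m → X) {v w : Fin m → ℝ} (h : Matrix.mulVec (regGram k lam a) v = w) :
    Matrix.mulVec (regGram k lam a)⁻¹ w = v := by
  rw [← h, Matrix.mulVec_mulVec, Matrix.nonsing_inv_mul _ (det_regGram_pos hk hlam a).ne'.isUnit,
    Matrix.one_mulVec]

theorem dotProduct_regGram_comm (hk : ∀ x y, k x y = inner ℝ (φ x) (φ y)) (a : Fin m → X)
    (v w : Fin m → ℝ) :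
    v ⬝ᵥ Matrix.mulVec (regGram k lam a) w = Matrix.mulVec (regGram k lam a) v ⬝ᵥ w := by
  rw [regGram_mulVec, regGram_mulVec, dotProduct_add, add_dotProduct,
    ← inner_sum_smul_sum_smul hk, dotProduct_comm _ w, ← inner_sum_smul_sum_smul hk,
    real_inner_comm]
  simp [dotProduct_smul, smul_dotProduct]

theorem regGram_mulVec_postWeights (hk : ∀ x y, k x y = inner ℝ (φ x) (φ y)) (hlam : 0 < lam)
    (a : Fin m → X) (z : X) :
    Matrix.mulVec (regGram k lam a) (postWeights k lam a z) = fun i => k (a i) z :=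
  regGram_mulVec_inv hk hlam a _

theorem postMean_eq_postWeights_dotProduct (hk : ∀ x y, k x y = inner ℝ (φ x) (φ y))
    (hlam : 0 < lam) (a : Fin m → X) (y : Fin m → ℝ) (z : X) :
    postMean k lam a y z = postWeights k lam a z ⬝ᵥ y := by
  have h := dotProduct_regGram_comm (lam := lam) hk a (postWeights k lam a z)
    (Matrix.mulVec (regGram k lam a)⁻¹ y)
  rw [regGram_mulVec_inv hk hlam, regGram_mulVec_postWeights hk hlam] at h
  exact h.symm

theorem postVar_eq_sub (a : Fin m → X) (z : X) :
    postVar k lam a z = k z z - (fun i => k (a i) z) ⬝ᵥ postWeights k lam a z := rfl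

/-- The inner product of `k_A(z)` with its weights is the energy `‖Φᵀα‖² + λ|α|²` of the weights. -/
theorem dotProduct_postWeights (hk : ∀ x y, k x y = inner ℝ (φ x) (φ y)) (hlam : 0 < lam)
    (a : Fin m → X) (z : X) :
    (fun i => k (a i) z) ⬝ᵥ postWeights k lam a z =
      ‖∑ i, postWeights k lam a z i • φ (a i)‖ ^ 2 +
        lam * (postWeights k lam a z ⬝ᵥ postWeights k lam a z) := by
  nth_rw 1 [← regGram_mulVec_postWeights hk hlam a z]
  rw [regGram_mulVec, add_dotProduct, dotProduct_comm, ← inner_sum_smul_sum_smul hk,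
    real_inner_self_eq_norm_sq, smul_dotProduct, smul_eq_mul]

/-- The posterior variance is the regularized squared distance of the feature vector at `z` from
the combination of the sampled feature vectors given by the posterior weights. -/
theorem postVar_eq_norm_sq (hk : ∀ x y, k x y = inner ℝ (φ x) (φ y)) (hlam : 0 < lam)
    (a : Fin m → X) (z : X) :
    postVar k lam a z = ‖φ z - ∑ i, postWeights k lam a z i • φ (a i)‖ ^ 2 +
      lam * (postWeights k lam a z ⬝ᵥ postWeights k lam a z) := by
  rw [norm_sub_sq_real, inner_sum_smul_feature hk, postVar_eq_sub, hk z z,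
    real_inner_self_eq_norm_sq]
  linarith [dotProduct_postWeights hk hlam a z]

theorem dotProduct_self_real_nonneg (v : Fin m → ℝ) : 0 ≤ v ⬝ᵥ v :=
  Finset.sum_nonneg fun i _ => mul_self_nonneg (v i)

theorem postVar_nonneg (hk : ∀ x y, k x y = inner ℝ (φ x) (φ y)) (hlam : 0 < lam)
    (a : Fin m → X) (z : X) : 0 ≤ postVar k lam a z := by
  rw [postVar_eq_norm_sq hk hlam]
  have := dotProduct_self_real_nonneg (postWeights k lam a z)
  positivity

theorem postVar_le (hk : ∀ x y, k x y = inner ℝ (φ x) (φ y)) (hlam : 0 < lam)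
    (a : Fin m → X) (z : X) : postVar k lam a z ≤ k z z := by
  rw [postVar_eq_sub, dotProduct_postWeights hk hlam]
  have := dotProduct_self_real_nonneg (postWeights k lam a z)
  have : 0 ≤ lam * (postWeights k lam a z ⬝ᵥ postWeights k lam a z) := by positivity
  linarith [sq_nonneg ‖∑ i, postWeights k lam a z i • φ (a i)‖]

theorem mul_dotProduct_postWeights_self_le (hk : ∀ x y, k x y = inner ℝ (φ x) (φ y))
    (hlam : 0 < lam) (a : Fin m → X) (z : X) :
    lam * (postWeights k lam a z ⬝ᵥ postWeights k lam a z) ≤ k z z := by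
  have h := postVar_eq_norm_sq hk hlam a z
  linarith [postVar_le hk hlam a z, sq_nonneg ‖φ z - ∑ i, postWeights k lam a z i • φ (a i)‖]

/-- Noiseless observations of a fixed function are interpolated up to its norm times the posterior
standard deviation. -/
theorem abs_sub_postMean_le (hk : ∀ x y, k x y = inner ℝ (φ x) (φ y)) (hlam : 0 < lam)
    (a : Fin m → X) (z : X) (h : E) :
    |inner ℝ (φ z) h - postMean k lam a (fun i => inner ℝ (φ (a i)) h) z| ≤
      ‖h‖ * √(postVar k lam a z) := by
  have h1 : inner ℝ (φ z) h - postMean k lam a (fun i => inner ℝ (φ (a i)) h) z =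
      inner ℝ (φ z - ∑ i, postWeights k lam a z i • φ (a i)) h := by
    rw [postMean_eq_postWeights_dotProduct hk hlam, inner_sub_left, sum_inner]
    simp [inner_smul_left, dotProduct]
  rw [h1, mul_comm]
  refine (abs_real_inner_le_norm _ _).trans (mul_le_mul_of_nonneg_right ?_ (norm_nonneg _))
  apply Real.le_sqrt_of_sq_le
  rw [postVar_eq_norm_sq hk hlam]
  have := dotProduct_self_real_nonneg (postWeights k lam a z)
  have : 0 ≤ lam * (postWeights k lam a z ⬝ᵥ postWeights k lam a z) := by positivity
  linarith

/-- Cauchy–Schwarz for the regularized energy: the posterior mean of a noise vector is at most the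
posterior standard deviation times the self-normalized norm of the noise. -/
theorem postMean_sq_le (hk : ∀ x y, k x y = inner ℝ (φ x) (φ y)) (hlam : 0 < lam)
    (a : Fin m → X) (y : Fin m → ℝ) (z : X) :
    postMean k lam a y z ^ 2 ≤ postVar k lam a z / lam * selfNormalizedSq k lam a y := by
  set w := Matrix.mulVec (regGram k lam a)⁻¹ y with hw
  set α := postWeights k lam a z with hα
  set θ : E := ∑ i, w i • φ (a i) with hθ
  set ψ : E := φ z - ∑ i, α i • φ (a i) with hψ
  have hAw : Matrix.mulVec (gramMatrix k a) w + lam • w = y := by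
    rw [← regGram_mulVec, hw, regGram_mulVec_inv hk hlam]
  set v := Matrix.mulVec (gramMatrix k a) w with hv
  have hθ2 : ‖θ‖ ^ 2 = w ⬝ᵥ v := by
    rw [← real_inner_self_eq_norm_sq, hθ, inner_sum_smul_sum_smul hk]
  have hQ : selfNormalizedSq k lam a y = lam * ‖θ‖ ^ 2 + v ⬝ᵥ v := by
    rw [selfNormalizedSq, ← hw, hθ2]
    nth_rw 1 2 3 [← hAw]
    simp only [dotProduct_add, add_dotProduct, dotProduct_smul, smul_dotProduct, smul_eq_mul]
    rw [dotProduct_comm v w]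
    ring
  have hmean : postMean k lam a y z = inner ℝ ψ θ + α ⬝ᵥ v := by
    have h1 : postMean k lam a y z = inner ℝ (φ z) θ := (inner_sum_smul_feature hk a w z).symm
    rw [h1, hψ, inner_sub_left, hθ, inner_sum_smul_sum_smul hk]
    ring
  have hc1 : |inner ℝ ψ θ| ≤ ‖ψ‖ * ‖θ‖ := abs_real_inner_le_norm _ _
  have hc2 : (α ⬝ᵥ v) ^ 2 ≤ (α ⬝ᵥ α) * (v ⬝ᵥ v) := by
    have := Finset.sum_mul_sq_le_sq_mul_sq Finset.univ α v
    simpa [dotProduct, sq] using this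
  rw [hmean, hQ, postVar_eq_norm_sq hk hlam]
  have hα0 := dotProduct_self_real_nonneg α
  have hv0 := dotProduct_self_real_nonneg v
  set p := inner ℝ ψ θ
  set q := α ⬝ᵥ v
  have hp : p ^ 2 ≤ ‖ψ‖ ^ 2 * ‖θ‖ ^ 2 := by
    rw [← sq_abs, ← mul_pow]; gcongr
  rw [← hα, ← hψ, div_mul_eq_mul_div, le_div_iff₀ hlam]
  have hcross : 2 * p * q * lam ≤ ‖ψ‖ ^ 2 * (v ⬝ᵥ v) + lam * (α ⬝ᵥ α) * (lam * ‖θ‖ ^ 2) := by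
    refine (le_abs_self _).trans (abs_le_of_sq_le_sq ?_ (by positivity))
    have h1 : p ^ 2 * q ^ 2 ≤ (‖ψ‖ ^ 2 * ‖θ‖ ^ 2) * ((α ⬝ᵥ α) * (v ⬝ᵥ v)) := by gcongr
    nlinarith [mul_le_mul_of_nonneg_left h1 (sq_nonneg lam),
      sq_nonneg (‖ψ‖ ^ 2 * (v ⬝ᵥ v) - lam * (α ⬝ᵥ α) * (lam * ‖θ‖ ^ 2))]
  nlinarith [mul_le_mul_of_nonneg_right hp hlam.le, mul_le_mul_of_nonneg_right hc2 hlam.le]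

/-- Solution of the regularized kernel system after one more sampling point, by elimination of the
last unknown. -/
theorem regGram_succ_inv_mulVec (hk : ∀ x y, k x y = inner ℝ (φ x) (φ y)) (hlam : 0 < lam)
    (a : Fin (m + 1) → X) (y : Fin (m + 1) → ℝ) :
    Matrix.mulVec (regGram k lam a)⁻¹ y =
      Fin.snoc (α := fun _ => ℝ)
        (Matrix.mulVec (regGram k lam (Fin.init a))⁻¹ (Fin.init y) -
          ((y (Fin.last m) - postMean k lam (Fin.init a) (Fin.init y) (a (Fin.last m))) /
            (postVar k lam (Fin.init a) (a (Fin.last m)) + lam)) •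
              postWeights k lam (Fin.init a) (a (Fin.last m)))
        ((y (Fin.last m) - postMean k lam (Fin.init a) (Fin.init y) (a (Fin.last m))) /
          (postVar k lam (Fin.init a) (a (Fin.last m)) + lam)) := by
  apply regGram_inv_mulVec_eq hk hlam
  have hs : postVar k lam (Fin.init a) (a (Fin.last m)) + lam ≠ 0 :=
    (add_pos_of_nonneg_of_pos (postVar_nonneg hk hlam _ _) hlam).ne'
  have hsc : ((y (Fin.last m) - postMean k lam (Fin.init a) (Fin.init y) (a (Fin.last m))) /
            (postVar k lam (Fin.init a) (a (Fin.last m)) + lam)) *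
            (postVar k lam (Fin.init a) (a (Fin.last m)) + lam) =
            y (Fin.last m) - postMean k lam (Fin.init a) (Fin.init y) (a (Fin.last m)) :=
    div_mul_cancel₀ _ hs
  set z := a (Fin.last m)
  set c := (y (Fin.last m) - postMean k lam (Fin.init a) (Fin.init y) z) /
            (postVar k lam (Fin.init a) z + lam)
  set w := Matrix.mulVec (regGram k lam (Fin.init a))⁻¹ (Fin.init y) with hw
  set α := postWeights k lam (Fin.init a) z with hα
  have hAw := regGram_mulVec_inv hk hlam (Fin.init a) (Fin.init y)
  have hAα := regGram_mulVec_postWeights hk hlam (Fin.init a) z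
  have hA : Matrix.mulVec (regGram k lam (Fin.init a)) (w - c • α) =
      Fin.init y - c • fun i => k (Fin.init a i) z := by
    rw [Matrix.mulVec_sub, Matrix.mulVec_smul, hAw, hAα]
  rw [regGram_mulVec] at hA ⊢
  ext i
  refine Fin.lastCases ?_ (fun j => ?_) i
  · have h2 : postMean k lam (Fin.init a) (Fin.init y) z =
        (fun i => k (Fin.init a i) z) ⬝ᵥ w := rfl
    have h3 := postVar_eq_sub (k := k) (lam := lam) (Fin.init a) z
    have h4 : (fun i => k z (Fin.init a i)) = fun i => k (Fin.init a i) z := by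
      ext i; rw [hk, hk, real_inner_comm]
    have h5 : Matrix.mulVec (gramMatrix k a) (Fin.snoc (α := fun _ => ℝ) (w - c • α) c)
        (Fin.last m) = (fun i => k z (Fin.init a i)) ⬝ᵥ (w - c • α) + k z z * c := by
      simp [Matrix.mulVec, dotProduct, Fin.sum_univ_castSucc, gramMatrix, Fin.init, z]
    rw [Pi.add_apply, h5, h4, dotProduct_sub, dotProduct_smul, Pi.smul_apply, Fin.snoc_last,
      ← h2, smul_eq_mul, smul_eq_mul]
    rw [h3] at hsc
    linarith
  · have h5 : Matrix.mulVec (gramMatrix k a) (Fin.snoc (α := fun _ => ℝ) (w - c • α) c)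
        j.castSucc = Matrix.mulVec (gramMatrix k (Fin.init a)) (w - c • α) j
          + k (Fin.init a j) z * c := by
      simp [Matrix.mulVec, dotProduct, Fin.sum_univ_castSucc, gramMatrix, Fin.init, z]
    have h6 := congrFun hA j
    simp only [Pi.add_apply, Pi.smul_apply, Pi.sub_apply, smul_eq_mul] at h6
    simp only [Pi.add_apply, Pi.smul_apply, Pi.sub_apply, smul_eq_mul, h5, Fin.snoc_castSucc]
    simp only [Fin.init] at h6 ⊢
    linarith

theorem selfNormalizedSq_succ (hk : ∀ x y, k x y = inner ℝ (φ x) (φ y)) (hlam : 0 < lam)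
    (a : Fin (m + 1) → X) (y : Fin (m + 1) → ℝ) :
    selfNormalizedSq k lam a y = selfNormalizedSq k lam (Fin.init a) (Fin.init y) +
      (2 * postMean k lam (Fin.init a) (Fin.init y) (a (Fin.last m)) * y (Fin.last m) +
        postVar k lam (Fin.init a) (a (Fin.last m)) / lam * y (Fin.last m) ^ 2 -
        postMean k lam (Fin.init a) (Fin.init y) (a (Fin.last m)) ^ 2) /
      (1 + postVar k lam (Fin.init a) (a (Fin.last m)) / lam) := by
  have hs : 0 < postVar k lam (Fin.init a) (a (Fin.last m)) + lam :=
    add_pos_of_nonneg_of_pos (postVar_nonneg hk hlam _ _) hlam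
  have hsplit : ∀ (v w : Fin (m + 1) → ℝ),
      v ⬝ᵥ w = Fin.init v ⬝ᵥ Fin.init w + v (Fin.last m) * w (Fin.last m) := fun v w => by
    simp [dotProduct, Fin.sum_univ_castSucc, Fin.init]
  have hmean := postMean_eq_postWeights_dotProduct hk hlam (Fin.init a) (Fin.init y)
    (a (Fin.last m))
  rw [selfNormalizedSq, selfNormalizedSq, regGram_succ_inv_mulVec hk hlam, hsplit y y, hsplit y,
    Fin.init_snoc, Fin.snoc_last, dotProduct_sub, dotProduct_smul,
    dotProduct_comm (Fin.init y) (postWeights _ _ _ _), ← hmean, smul_eq_mul]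
  have h1 : 1 + postVar k lam (Fin.init a) (a (Fin.last m)) / lam =
      (postVar k lam (Fin.init a) (a (Fin.last m)) + lam) / lam := by
    field_simp
    ring
  rw [h1]
  have h2 := hs.ne'
  field_simp
  ring

/-! ### Information gain -/

theorem det_one_add_inv_smul_gramMatrix (hlam : 0 < lam) (a : Fin m → X) :
    (1 + lam⁻¹ • gramMatrix k a).det = (lam⁻¹) ^ m * (regGram k lam a).det := by
  have : (1 + lam⁻¹ • gramMatrix k a) = lam⁻¹ • regGram k lam a := by
    rw [regGram, smul_add, smul_smul, inv_mul_cancel₀ hlam.ne', one_smul, add_comm]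
  rw [this, Matrix.det_smul, Fintype.card_fin]

/-- The determinant grows by the ratio of the predictive variance to the noise variance. The last
diagonal entry of the inverse matrix is this ratio by Cramer's rule. -/
theorem det_one_add_inv_smul_gramMatrix_succ (hk : ∀ x y, k x y = inner ℝ (φ x) (φ y))
    (hlam : 0 < lam) (a : Fin (m + 1) → X) :
    (1 + lam⁻¹ • gramMatrix k a).det = (1 + lam⁻¹ • gramMatrix k (Fin.init a)).det *
      (1 + postVar k lam (Fin.init a) (a (Fin.last m)) / lam) := by
  have hs : 0 < postVar k lam (Fin.init a) (a (Fin.last m)) + lam :=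
    add_pos_of_nonneg_of_pos (postVar_nonneg hk hlam _ _) hlam
  have hdet := det_regGram_pos hk hlam a
  have h1 := congrFun (regGram_succ_inv_mulVec hk hlam a (Pi.single (Fin.last m) 1)) (Fin.last m)
  have h0 : Fin.init (α := fun _ => ℝ) (Pi.single (Fin.last m) (1 : ℝ)) = 0 := by
    ext i; simp [Fin.init]
  rw [Matrix.mulVec_single_one, Fin.snoc_last, h0, postMean_eq_postWeights_dotProduct hk hlam,
    dotProduct_zero, Matrix.col_apply, Matrix.inv_def, Matrix.smul_apply,
    Matrix.adjugate_fin_succ_eq_det_submatrix, Ring.inverse_eq_inv'] at h1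
  have h2 : (regGram k lam a).submatrix (Fin.last m).succAbove (Fin.last m).succAbove =
      regGram k lam (Fin.init a) := by
    ext i j
    simp [regGram, gramMatrix, Fin.init, Matrix.one_apply]
  rw [h2] at h1
  simp only [Pi.single_eq_same, sub_zero, smul_eq_mul, Fin.val_last, ← two_mul, pow_mul,
    neg_one_sq, one_pow, one_mul] at h1
  rw [det_one_add_inv_smul_gramMatrix hlam, det_one_add_inv_smul_gramMatrix hlam]
  have h3 : (regGram k lam a).det = (regGram k lam (Fin.init a)).det *
      (postVar k lam (Fin.init a) (a (Fin.last m)) + lam) := by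
    field_simp at h1
    linarith
  rw [h3, pow_succ]
  field_simp
  ring

theorem det_one_add_inv_smul_gramMatrix_pos (hk : ∀ x y, k x y = inner ℝ (φ x) (φ y))
    (hlam : 0 < lam) (a : Fin m → X) : 0 < (1 + lam⁻¹ • gramMatrix k a).det := by
  rw [det_one_add_inv_smul_gramMatrix hlam]
  have := det_regGram_pos hk hlam a
  positivity

theorem log_det_succ (hk : ∀ x y, k x y = inner ℝ (φ x) (φ y)) (hlam : 0 < lam)
    (a : Fin (m + 1) → X) :
    Real.log (1 + lam⁻¹ • gramMatrix k a).det =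
      Real.log (1 + lam⁻¹ • gramMatrix k (Fin.init a)).det +
      Real.log (1 + postVar k lam (Fin.init a) (a (Fin.last m)) / lam) := by
  have := div_nonneg (postVar_nonneg hk hlam (Fin.init a) (a (Fin.last m))) hlam.le
  rw [det_one_add_inv_smul_gramMatrix_succ hk hlam,
    Real.log_mul (det_one_add_inv_smul_gramMatrix_pos hk hlam _).ne' (by positivity)]

theorem le_infoGain [Finite X] (k : X → X → ℝ) (lam : ℝ) (a : Fin m → X) :
    1 / 2 * Real.log (1 + lam⁻¹ • gramMatrix k a).det ≤ infoGain k lam m :=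
  le_ciSup (f := fun a : Fin m → X => 1 / 2 * Real.log (1 + lam⁻¹ • gramMatrix k a).det)
    (Set.finite_range _).bddAbove a

theorem infoGain_mono [Finite X] [Nonempty X] (hk : ∀ x y, k x y = inner ℝ (φ x) (φ y))
    (hlam : 0 < lam) : Monotone (infoGain k lam) := by
  refine monotone_nat_of_le_succ fun m => ciSup_le fun a => ?_
  refine le_trans ?_ (le_infoGain k lam (Fin.snoc (α := fun _ => X) a (Classical.arbitrary X)))
  rw [log_det_succ hk hlam, Fin.init_snoc]
  have := div_nonneg (postVar_nonneg hk hlam a (Classical.arbitrary X)) hlam.le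
  have := Real.log_nonneg (by simpa using this : 1 ≤ 1 + postVar k lam a _ / lam)
  rw [Fin.snoc_last]
  linarith

/-- Repeating one point `m` times gives the matrix `I + λ⁻¹ k(z, z) 1 1ᵀ`. -/
theorem half_log_one_add_le_infoGain [Finite X] (k : X → X → ℝ) (lam : ℝ) (m : ℕ) (z : X) :
    1 / 2 * Real.log (1 + m * (lam⁻¹ * k z z)) ≤ infoGain k lam m := by
  convert le_infoGain k lam (fun _ : Fin m => z) using 3
  have h : (1 + lam⁻¹ • gramMatrix k (fun _ : Fin m => z)) =
      1 + Matrix.replicateCol Unit (fun _ : Fin m => lam⁻¹ * k z z) *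
        Matrix.replicateRow Unit (fun _ : Fin m => (1 : ℝ)) := by
    ext i j; simp [gramMatrix, Matrix.mul_apply]
  rw [h, Matrix.det_one_add_replicateCol_mul_replicateRow]
  simp [dotProduct]

theorem infoGain_one [Finite X] [Nonempty X] (k : X → X → ℝ) (lam : ℝ) :
    ∃ z, infoGain k lam 1 = 1 / 2 * Real.log (1 + lam⁻¹ * k z z) := by
  obtain ⟨a, ha⟩ := exists_eq_ciSup_of_finite
    (f := fun a : Fin 1 → X => 1 / 2 * Real.log (1 + lam⁻¹ • gramMatrix k a).det)
  refine ⟨a 0, ?_⟩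
  rw [infoGain, ← ha]
  simp [gramMatrix]

end Algebra

/-! ### Sub-Gaussian noise and one-dimensional mixtures -/

section SubGaussian

open ProbabilityTheory Filter Topology ENNReal

variable {Ω : Type*} {m mΩ : MeasurableSpace Ω} {P : Measure Ω} {R : ℝ} {Z : Ω → ℝ}

theorem setLIntegral_exp_le_of_condSubGaussian [IsProbabilityMeasure P] (hm : m ≤ mΩ)
    (hZ : CondSubGaussian m P R Z) (s : ℝ) {A : Set Ω} (hA : MeasurableSet[m] A) :
    ∫⁻ ω in A, ENNReal.ofReal (Real.exp (s * Z ω)) ∂P ≤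
      ENNReal.ofReal (Real.exp (s ^ 2 * R ^ 2 / 2)) * P A := by
  obtain ⟨hint, hle⟩ := hZ s
  rw [← ofReal_integral_eq_lintegral_ofReal hint.integrableOn
    (Eventually.of_forall fun ω => (Real.exp_pos _).le), ← setIntegral_condExp hm hint hA]
  calc ENNReal.ofReal (∫ ω in A, (P[fun ω => Real.exp (s * Z ω) | m]) ω ∂P)
      ≤ ENNReal.ofReal (∫ _ in A, Real.exp (s ^ 2 * R ^ 2 / 2) ∂P) := by
        refine ENNReal.ofReal_le_ofReal (integral_mono_ae integrable_condExp.integrableOn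
          (integrable_const _) (ae_restrict_of_ae hle))
    _ = _ := by
        rw [setIntegral_const, smul_eq_mul, mul_comm, ENNReal.ofReal_mul (Real.exp_pos _).le,
          measureReal_def, ENNReal.ofReal_toReal (measure_ne_top _ _)]

theorem lintegral_mul_exp_le_of_condSubGaussian [IsProbabilityMeasure P] (hm : m ≤ mΩ)
    (hZm : Measurable Z) (hZ : CondSubGaussian m P R Z) (s : ℝ) {M : Ω → ℝ≥0∞}
    (hM : Measurable[m] M) :
    ∫⁻ ω, M ω * ENNReal.ofReal (Real.exp (s * Z ω - s ^ 2 * R ^ 2 / 2)) ∂P ≤ ∫⁻ ω, M ω ∂P := by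
  set D : Ω → ℝ≥0∞ := fun ω => ENNReal.ofReal (Real.exp (s * Z ω - s ^ 2 * R ^ 2 / 2)) with hD
  have hDm : Measurable D := by fun_prop
  have hle : (P.withDensity D).trim hm ≤ P.trim hm := by
    refine Measure.le_iff.2 fun A hA => ?_
    rw [trim_measurableSet_eq hm hA, trim_measurableSet_eq hm hA, withDensity_apply _ (hm _ hA)]
    have h1 : ∀ ω, D ω = ENNReal.ofReal (Real.exp (-(s ^ 2 * R ^ 2 / 2))) *
        ENNReal.ofReal (Real.exp (s * Z ω)) := fun ω => by
      rw [← ENNReal.ofReal_mul (Real.exp_pos _).le, ← Real.exp_add, neg_add_eq_sub]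
    simp_rw [h1]
    rw [lintegral_const_mul _ (by fun_prop)]
    calc _ ≤ ENNReal.ofReal (Real.exp (-(s ^ 2 * R ^ 2 / 2))) *
          (ENNReal.ofReal (Real.exp (s ^ 2 * R ^ 2 / 2)) * P A) := by
          gcongr; exact setLIntegral_exp_le_of_condSubGaussian hm hZ s hA
      _ = P A := by
          rw [← mul_assoc, ← ENNReal.ofReal_mul (Real.exp_pos _).le, ← Real.exp_add]
          simp
  calc ∫⁻ ω, M ω * D ω ∂P = ∫⁻ ω, M ω ∂(P.withDensity D) := by
        rw [lintegral_withDensity_eq_lintegral_mul _ hDm (hM.mono hm le_rfl)]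
        simp [mul_comm]
    _ = ∫⁻ ω, M ω ∂((P.withDensity D).trim hm) := (lintegral_trim hm hM).symm
    _ ≤ ∫⁻ ω, M ω ∂(P.trim hm) := lintegral_mono' hle le_rfl
    _ = ∫⁻ ω, M ω ∂P := lintegral_trim hm hM

/-- The sub-Gaussian bound with a predictable exponent `Y` in place of a constant. The exponent is
approximated by variables with countably many values, and Fatou's lemma gives the limit. -/
theorem lintegral_mul_exp_le_of_measurable [IsProbabilityMeasure P] (hm : m ≤ mΩ)
    (hZm : Measurable Z) (hZ : CondSubGaussian m P R Z) {M : Ω → ℝ≥0∞} (hM : Measurable[m] M)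
    {Y : Ω → ℝ} (hY : Measurable[m] Y) :
    ∫⁻ ω, M ω * ENNReal.ofReal (Real.exp (Y ω * Z ω - Y ω ^ 2 * R ^ 2 / 2)) ∂P ≤
      ∫⁻ ω, M ω ∂P := by
  set F : ℝ → Ω → ℝ≥0∞ := fun y ω =>
    ENNReal.ofReal (Real.exp (y * Z ω - y ^ 2 * R ^ 2 / 2)) with hF
  set J : ℕ → Ω → ℤ := fun i ω => ⌊Y ω * (i + 1 : ℕ)⌋ with hJ
  have hJm : ∀ i, Measurable[m] (J i) := fun i =>
    Int.measurable_floor.comp (hY.mul_const _)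
  have hdisc : ∀ i, ∫⁻ ω, M ω * F (J i ω / (i + 1 : ℕ)) ω ∂P ≤ ∫⁻ ω, M ω ∂P := fun i => by
    have hA : ∀ j : ℤ, MeasurableSet[m] (J i ⁻¹' {j}) := fun j =>
      hJm i (measurableSet_singleton j)
    have hsplit : ∀ g : Ω → ℝ≥0∞, ∫⁻ ω, g ω ∂P = ∑' j : ℤ, ∫⁻ ω in J i ⁻¹' {j}, g ω ∂P := by
      intro g
      rw [← lintegral_iUnion (fun j => hm _ (hA j)), ← Set.preimage_iUnion, Set.iUnion_of_singleton,
        Set.preimage_univ, setLIntegral_univ]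
      · intro j j' hjj'
        exact Disjoint.preimage _ (by simpa using hjj')
    rw [hsplit, hsplit M]
    refine ENNReal.tsum_le_tsum fun j => ?_
    have h1 := lintegral_mul_exp_le_of_condSubGaussian hm hZm hZ (j / (i + 1 : ℕ))
      (hM.indicator (hA j))
    rw [← lintegral_indicator (hm _ (hA j)), ← lintegral_indicator (hm _ (hA j))]
    refine le_trans (lintegral_mono fun ω => ?_) h1
    by_cases hω : ω ∈ J i ⁻¹' {j}
    · have : J i ω = j := hω
      simp [hF, this]
    · simp [Set.indicator_of_notMem hω]
  have hlim : ∀ ω, Tendsto (fun i : ℕ => (J i ω : ℝ) / (i + 1 : ℕ)) atTop (𝓝 (Y ω)) := fun ω => by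
    have h0 : Tendsto (fun i : ℕ => Y ω - 1 / ((i : ℝ) + 1)) atTop (𝓝 (Y ω)) := by
      simpa using tendsto_const_nhds.sub (tendsto_one_div_add_atTop_nhds_zero_nat (𝕜 := ℝ))
    refine tendsto_of_tendsto_of_tendsto_of_le_of_le h0 tendsto_const_nhds (fun i => ?_)
      (fun i => ?_)
    · have hi : (0 : ℝ) < (i + 1 : ℕ) := by positivity
      have := (Int.sub_one_lt_floor (Y ω * (i + 1 : ℕ))).le
      rw [le_div_iff₀ hi, sub_mul, ← Nat.cast_add_one, one_div_mul_cancel hi.ne']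
      exact this
    · have hi : (0 : ℝ) < (i + 1 : ℕ) := by positivity
      rw [div_le_iff₀ hi]
      exact Int.floor_le _
  have hlimF : ∀ ω, Tendsto (fun i : ℕ => M ω * F (J i ω / (i + 1 : ℕ)) ω) atTop
      (𝓝 (M ω * F (Y ω) ω)) := fun ω => by
    refine ENNReal.Tendsto.const_mul ?_ (Or.inl (by simp [hF, Real.exp_pos]))
    have : Continuous fun y => F y ω := by
      simp only [hF]
      exact ENNReal.continuous_ofReal.comp (by fun_prop)
    exact (this.tendsto _).comp (hlim ω)
  calc ∫⁻ ω, M ω * F (Y ω) ω ∂P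
      = ∫⁻ ω, liminf (fun i : ℕ => M ω * F (J i ω / (i + 1 : ℕ)) ω) atTop ∂P := by
        simp_rw [(hlimF _).liminf_eq]
    _ ≤ liminf (fun i : ℕ => ∫⁻ ω, M ω * F (J i ω / (i + 1 : ℕ)) ω ∂P) atTop := by
        refine lintegral_liminf_le fun i => (hM.mono hm le_rfl).mul ?_
        have : Measurable fun ω => (J i ω : ℝ) :=
          measurable_from_top.comp ((hJm i).mono hm le_rfl)
        simp only [hF]
        fun_prop
    _ ≤ ∫⁻ ω, M ω ∂P := liminf_le_of_le (by isBoundedDefault) fun b hb => by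
        obtain ⟨i, hi⟩ := hb.exists
        exact hi.trans (hdisc i)

/-- Gaussian mixture of the exponentials `exp (s z - s² / 2)` over `s` with mean `a` and variance
`v ^ 2`, by completing the square. -/
theorem lintegral_exp_gaussianReal (a v z : ℝ) :
    ∫⁻ ξ, ENNReal.ofReal (Real.exp ((a + v * ξ) * z - (a + v * ξ) ^ 2 / 2)) ∂(gaussianReal 0 1) =
      ENNReal.ofReal (Real.exp ((2 * a * z + v ^ 2 * z ^ 2 - a ^ 2) / (2 * (1 + v ^ 2))) /
        √(1 + v ^ 2)) := by
  have hv : 0 < 1 + v ^ 2 := by positivity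
  set w : NNReal := ⟨1 / (1 + v ^ 2), by positivity⟩ with hw
  have hw0 : w ≠ 0 := by
    have : 0 < (w : ℝ) := by rw [hw]; change 0 < 1 / (1 + v ^ 2); positivity
    exact fun h => this.ne' (by rw [h]; rfl)
  rw [gaussianReal_of_var_ne_zero _ one_ne_zero,
    lintegral_withDensity_eq_lintegral_mul _ (measurable_gaussianPDF _ _) (by fun_prop)]
  have hpt : ∀ ξ : ℝ, (gaussianPDF 0 1 *
      fun ξ => ENNReal.ofReal (Real.exp ((a + v * ξ) * z - (a + v * ξ) ^ 2 / 2))) ξ =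
      ENNReal.ofReal (Real.exp ((2 * a * z + v ^ 2 * z ^ 2 - a ^ 2) / (2 * (1 + v ^ 2))) /
        √(1 + v ^ 2)) * ENNReal.ofReal (gaussianPDFReal (v * (z - a) / (1 + v ^ 2)) w ξ) := by
    intro ξ
    rw [Pi.mul_apply, gaussianPDF, ← ENNReal.ofReal_mul (gaussianPDFReal_nonneg _ _ _),
      ← ENNReal.ofReal_mul (by positivity)]
    congr 1
    rw [gaussianPDFReal, gaussianPDFReal]
    have hwr : (w : ℝ) = 1 / (1 + v ^ 2) := rfl
    have h2 : √(2 * Real.pi * (w : ℝ)) * √(1 + v ^ 2) = √(2 * Real.pi) := by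
      rw [← Real.sqrt_mul (by positivity), hwr]
      congr 1; field_simp
    have h3 : √(1 + v ^ 2) ≠ 0 := (Real.sqrt_pos.2 hv).ne'
    have h4 : √(2 * Real.pi * (w : ℝ)) ≠ 0 := fun h => by
      rw [h, zero_mul] at h2
      exact (Real.sqrt_pos.2 (by positivity : 0 < 2 * Real.pi)).ne h2
    have h5 : (√(2 * Real.pi * ((1 : NNReal) : ℝ)))⁻¹ =
        (√(1 + v ^ 2))⁻¹ * (√(2 * Real.pi * (w : ℝ)))⁻¹ := by
      rw [NNReal.coe_one, mul_one, ← h2, mul_inv, mul_comm]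
    
    have h6 : -(ξ - 0) ^ 2 / (2 * ((1 : NNReal) : ℝ)) +
          ((a + v * ξ) * z - (a + v * ξ) ^ 2 / 2) =
        (2 * a * z + v ^ 2 * z ^ 2 - a ^ 2) / (2 * (1 + v ^ 2)) +
        -(ξ - v * (z - a) / (1 + v ^ 2)) ^ 2 / (2 * (w : ℝ)) := by
      rw [hwr, NNReal.coe_one]
      field_simp
      ring
    calc _ = (√(1 + v ^ 2))⁻¹ * (√(2 * Real.pi * (w : ℝ)))⁻¹ *
          Real.exp (-(ξ - 0) ^ 2 / (2 * ((1 : NNReal) : ℝ)) +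
            ((a + v * ξ) * z - (a + v * ξ) ^ 2 / 2)) := by rw [h5, Real.exp_add]; ring
      _ = _ := by rw [h6, Real.exp_add]; ring
  simp_rw [hpt]
  rw [lintegral_const_mul _ (measurable_gaussianPDFReal _ _).ennreal_ofReal,
    lintegral_gaussianPDFReal_eq_one _ hw0, mul_one]

/-- One step of the method of mixtures. The prior over exponents at each step is the Gaussian
posterior of the previous steps, so that all mixtures are one-dimensional. -/
theorem lintegral_mul_mixture_le [IsProbabilityMeasure P] (hm : m ≤ mΩ) (hR : 0 < R)
    (hZm : Measurable Z) (hZ : CondSubGaussian m P R Z) {M : Ω → ℝ≥0∞} (hM : Measurable[m] M)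
    {a u : Ω → ℝ} (ha : Measurable[m] a) (hu : Measurable[m] u) (hu0 : ∀ ω, 0 ≤ u ω) :
    ∫⁻ ω, M ω * ENNReal.ofReal
      (Real.exp ((2 * a ω * Z ω + u ω * Z ω ^ 2 - a ω ^ 2) / (1 + u ω) / (2 * R ^ 2)) /
        √(1 + u ω)) ∂P ≤ ∫⁻ ω, M ω ∂P := by
  have hmix : ∀ ω, ENNReal.ofReal
      (Real.exp ((2 * a ω * Z ω + u ω * Z ω ^ 2 - a ω ^ 2) / (1 + u ω) / (2 * R ^ 2)) /
        √(1 + u ω)) = ∫⁻ ξ, ENNReal.ofReal (Real.exp (((a ω + √(u ω) * R * ξ) / R ^ 2) * Z ω -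
          ((a ω + √(u ω) * R * ξ) / R ^ 2) ^ 2 * R ^ 2 / 2)) ∂(gaussianReal 0 1) := fun ω => by
    have h1 := lintegral_exp_gaussianReal (a ω / R) (√(u ω)) (Z ω / R)
    rw [Real.sq_sqrt (hu0 ω)] at h1
    have h2 := hu0 ω
    have h3 : (2 * a ω * Z ω + u ω * Z ω ^ 2 - a ω ^ 2) / (1 + u ω) / (2 * R ^ 2) =
        (2 * (a ω / R) * (Z ω / R) + u ω * (Z ω / R) ^ 2 - (a ω / R) ^ 2) / (2 * (1 + u ω)) := by
      field_simp
    rw [h3, ← h1]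
    refine lintegral_congr fun ξ => ?_
    congr 2
    field_simp
  have hMm := hM.mono hm le_rfl
  have ham := ha.mono hm le_rfl
  have hum := hu.mono hm le_rfl
  simp_rw [hmix]
  calc _ = ∫⁻ ω, ∫⁻ ξ, M ω * ENNReal.ofReal (Real.exp (((a ω + √(u ω) * R * ξ) / R ^ 2) * Z ω -
          ((a ω + √(u ω) * R * ξ) / R ^ 2) ^ 2 * R ^ 2 / 2)) ∂(gaussianReal 0 1) ∂P := by
        refine lintegral_congr fun ω => ?_
        rw [lintegral_const_mul _ (by fun_prop)]
    _ = ∫⁻ ξ, ∫⁻ ω, M ω * ENNReal.ofReal (Real.exp (((a ω + √(u ω) * R * ξ) / R ^ 2) * Z ω -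
          ((a ω + √(u ω) * R * ξ) / R ^ 2) ^ 2 * R ^ 2 / 2)) ∂P ∂(gaussianReal 0 1) := by
        refine lintegral_lintegral_swap (Measurable.aemeasurable ?_)
        simp only [Function.uncurry_def]
        fun_prop
    _ ≤ ∫⁻ _, ∫⁻ ω, M ω ∂P ∂(gaussianReal 0 1) := by
        refine lintegral_mono fun ξ => lintegral_mul_exp_le_of_measurable hm hZm hZ hM ?_
        exact (ha.add ((hu.sqrt.mul_const R).mul_const ξ)).div_const _
    _ = ∫⁻ ω, M ω ∂P := by simp

/-- Zero conditional sub-Gaussian parameter forces the noise to vanish, since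
`exp z + exp (-z) ≥ 2` with equality only at `0`. -/
theorem ae_eq_zero_of_condSubGaussian_zero [IsProbabilityMeasure P] (hm : m ≤ mΩ)
    (hZ : CondSubGaussian m P 0 Z) : ∀ᵐ ω ∂P, Z ω = 0 := by
  have hint : ∀ s : ℝ, ∫ ω, Real.exp (s * Z ω) ∂P ≤ 1 := fun s => by
    rw [← integral_condExp hm]
    calc _ ≤ ∫ _, Real.exp (s ^ 2 * 0 ^ 2 / 2) ∂P :=
          integral_mono_ae integrable_condExp (integrable_const _) (hZ s).2
      _ = 1 := by simp
  have hi : Integrable (fun ω => Real.exp (1 * Z ω) + Real.exp (-1 * Z ω) - 2) P :=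
    ((hZ 1).1.add (hZ (-1)).1).sub (integrable_const _)
  have hpt : ∀ z : ℝ, Real.exp (1 * z) + Real.exp (-1 * z) - 2 =
      (Real.exp (z / 2) - Real.exp (-(z / 2))) ^ 2 := fun z => by
    rw [sub_sq, ← Real.exp_nat_mul, ← Real.exp_nat_mul, mul_assoc, ← Real.exp_add]
    push_cast
    rw [add_neg_cancel, Real.exp_zero]
    ring_nf
  have h0 : 0 ≤ fun ω => Real.exp (1 * Z ω) + Real.exp (-1 * Z ω) - 2 := fun ω => by
    simp only [Pi.zero_apply, hpt]
    positivity
  have hz : ∫ ω, (Real.exp (1 * Z ω) + Real.exp (-1 * Z ω) - 2) ∂P = 0 := by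
    refine le_antisymm ?_ (integral_nonneg h0)
    have h2 : ∫ ω, (Real.exp (1 * Z ω) + Real.exp (-1 * Z ω) - 2) ∂P =
        ∫ ω, Real.exp (1 * Z ω) ∂P + ∫ ω, Real.exp (-1 * Z ω) ∂P - ∫ _, (2 : ℝ) ∂P := by
      rw [← integral_add (hZ 1).1 (hZ (-1)).1]
      exact integral_sub ((hZ 1).1.add (hZ (-1)).1) (integrable_const _)
    have h3 := hint 1
    have h4 := hint (-1)
    rw [h2, integral_const, probReal_univ, one_smul]
    linarith
  filter_upwards [(integral_eq_zero_iff_of_nonneg h0 hi).1 hz] with ω hω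
  simp only [Pi.zero_apply, hpt] at hω
  have := Real.exp_injective (sub_eq_zero.1 (pow_eq_zero_iff two_ne_zero |>.1 hω))
  linarith

end SubGaussian

/-! ### Maximal inequality and self-normalized tails -/

section Maximal

open ENNReal

variable {Ω : Type*} {mΩ : MeasurableSpace Ω} {P : Measure Ω}

/-- Ville's inequality for finitely many steps of a nonnegative supermartingale with values in
`[0, ∞]`: on the event that the level `K` has not been reached yet the supermartingale property
still holds, so mass which reaches `K` is accounted for at most once. -/
theorem mul_measure_exists_le_le_one [IsProbabilityMeasure P] (𝒢 : Filtration ℕ mΩ)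
    {M : ℕ → Ω → ℝ≥0∞} {L : ℕ} (hM0 : ∀ ω, M 0 ω ≤ 1) (hM : ∀ i ≤ L, Measurable[𝒢 i] (M i))
    (hstep : ∀ i < L, ∀ A, MeasurableSet[𝒢 i] A →
      ∫⁻ ω in A, M (i + 1) ω ∂P ≤ ∫⁻ ω in A, M i ω ∂P) (K : ℝ≥0∞) :
    K * P {ω | ∃ i ≤ L, K ≤ M i ω} ≤ 1 := by
  have hE : ∀ i ≤ L, MeasurableSet[𝒢 i] {ω | ∃ j ≤ i, K ≤ M j ω} := fun i hi => by
    have : {ω | ∃ j ≤ i, K ≤ M j ω} = ⋃ j ∈ Finset.range (i + 1), {ω | K ≤ M j ω} := by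
      ext ω; simp
    rw [this]
    refine Finset.measurableSet_biUnion _ fun j hj => ?_
    have hji : j ≤ i := Nat.lt_succ_iff.1 (Finset.mem_range.1 hj)
    exact ((hM j (hji.trans hi)).mono (𝒢.mono hji) le_rfl) measurableSet_Ici
  have key : ∀ i ≤ L, K * P {ω | ∃ j ≤ i, K ≤ M j ω} +
      ∫⁻ ω in {ω | ∃ j ≤ i, K ≤ M j ω}ᶜ, M i ω ∂P ≤ 1 := by
    -- moving a set `B` where `N ≥ K` into the exceedance set does not increase the total
    have hpass : ∀ (S : Set Ω) (N : Ω → ℝ≥0∞) (B : Set Ω), MeasurableSet S → MeasurableSet B →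
        (∀ ω ∈ B, K ≤ N ω) → Disjoint S B → K * P (S ∪ B) + ∫⁻ ω in (S ∪ B)ᶜ, N ω ∂P ≤
          K * P S + ∫⁻ ω in Sᶜ, N ω ∂P := fun S N B hS hB hK hd => by
      have h1 : Sᶜ = B ∪ (S ∪ B)ᶜ := by
        ext ω
        have : ω ∈ S → ω ∉ B := fun h => Set.disjoint_left.1 hd h
        simp only [Set.mem_compl_iff, Set.mem_union]
        tauto
      rw [measure_union hd hB, mul_add, add_assoc, h1, lintegral_union (hS.union hB).compl]
      · gcongr
        rw [← setLIntegral_const]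
        exact setLIntegral_mono' hB hK
      · exact Set.disjoint_left.2 fun ω h2 h3 => h3 (Or.inr h2)
    intro i
    induction i with
    | zero =>
      intro _
      have h := hpass ∅ (M 0) {ω | ∃ j ≤ 0, K ≤ M j ω} MeasurableSet.empty
        (𝒢.le _ _ (hE 0 (Nat.zero_le _))) (fun ω ⟨j, hj, h⟩ => by rwa [Nat.le_zero.1 hj] at h)
        (Set.empty_disjoint _)
      rw [Set.empty_union] at h
      refine h.trans ?_
      rw [measure_empty, mul_zero, zero_add, Set.compl_empty, setLIntegral_univ]
      calc ∫⁻ ω, M 0 ω ∂P ≤ ∫⁻ _, 1 ∂P := lintegral_mono hM0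
        _ = 1 := by simp
    | succ i ih =>
      intro hi
      have hEi := hE i (Nat.le_of_succ_le hi)
      have h := hpass {ω | ∃ j ≤ i, K ≤ M j ω} (M (i + 1))
        ({ω | ∃ j ≤ i + 1, K ≤ M j ω} \ {ω | ∃ j ≤ i, K ≤ M j ω})
        (𝒢.le _ _ hEi) ((𝒢.le _ _ (hE (i + 1) hi)).diff (𝒢.le _ _ hEi))
        (fun ω ⟨⟨j, hj, h⟩, h2⟩ => by
          rcases Nat.le_succ_iff.1 hj with hj | hj
          · exact absurd ⟨j, hj, h⟩ h2
          · rwa [hj] at h) Set.disjoint_sdiff_right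
      have hsub : {ω | ∃ j ≤ i, K ≤ M j ω} ⊆ {ω | ∃ j ≤ i + 1, K ≤ M j ω} :=
        fun ω ⟨j, hj, h⟩ => ⟨j, hj.trans (Nat.le_succ i), h⟩
      rw [Set.union_sdiff_cancel hsub] at h
      refine h.trans (le_trans ?_ (ih (Nat.le_of_succ_le hi)))
      refine add_le_add le_rfl ?_
      exact hstep i hi _ hEi.compl
  exact le_self_add.trans (key L le_rfl)

/-- Self-normalized tail bound for predictable `a` and `u ≥ 0` and conditionally sub-Gaussian `Z`.
The case `R = 0` is separate because the exponential supermartingale divides by `R ^ 2`. -/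
theorem measure_exists_selfNormalized_gt_le [IsProbabilityMeasure P] (𝒢 : Filtration ℕ mΩ)
    {L : ℕ} {R δ : ℝ} (hR : 0 ≤ R) (hδ : 0 < δ) {a u Z : ℕ → Ω → ℝ}
    (ha : ∀ i < L, Measurable[𝒢 i] (a i)) (hu : ∀ i < L, Measurable[𝒢 i] (u i))
    (hu0 : ∀ i ω, 0 ≤ u i ω) (hZm : ∀ i < L, Measurable[𝒢 (i + 1)] (Z i))
    (hZ : ∀ i < L, CondSubGaussian (𝒢 i) P R (Z i)) :
    P {ω | ∃ i ≤ L, R ^ 2 * (2 * Real.log (1 / δ) + ∑ j ∈ Finset.range i, Real.log (1 + u j ω)) <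
      ∑ j ∈ Finset.range i, (2 * a j ω * Z j ω + u j ω * Z j ω ^ 2 - a j ω ^ 2) / (1 + u j ω)} ≤
      ENNReal.ofReal δ := by
  rcases hR.eq_or_lt with rfl | hR
  · have hae : ∀ᵐ ω ∂P, ∀ i ∈ Finset.range L, Z i ω = 0 :=
      (Finset.eventually_all _).2 fun i hi =>
        ae_eq_zero_of_condSubGaussian_zero (𝒢.le i) (hZ i (Finset.mem_range.1 hi))
    refine le_trans (le_of_eq ?_) bot_le
    refine measure_mono_null ?_ (ae_iff.1 hae)
    rintro ω ⟨i, hi, h⟩ h0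
    refine absurd h (not_lt.2 ?_)
    rw [zero_pow two_ne_zero, zero_mul]
    refine Finset.sum_nonpos fun j hj => ?_
    rw [h0 j (Finset.mem_range.2 ((Finset.mem_range.1 hj).trans_le hi))]
    have := hu0 j ω
    exact div_nonpos_of_nonpos_of_nonneg (by nlinarith [sq_nonneg (a j ω)]) (by linarith)
  · set D : ℕ → Ω → ℝ := fun j ω =>
      Real.exp ((2 * a j ω * Z j ω + u j ω * Z j ω ^ 2 - a j ω ^ 2) / (1 + u j ω) / (2 * R ^ 2)) /
        √(1 + u j ω) with hD
    set M : ℕ → Ω → ℝ≥0∞ := fun i ω => ∏ j ∈ Finset.range i, ENNReal.ofReal (D j ω) with hM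
    have hDpos : ∀ j ω, 0 < D j ω := fun j ω => by have := hu0 j ω; positivity
    have hDm : ∀ j < L, Measurable[𝒢 (j + 1)] (D j) := fun j hj => by
      have h1 := (ha j hj).mono (𝒢.mono (Nat.le_succ j)) le_rfl
      have h2 := (hu j hj).mono (𝒢.mono (Nat.le_succ j)) le_rfl
      have h3 := hZm j hj
      exact (((((h1.const_mul 2).mul h3).add (h2.mul (h3.pow_const 2))).sub
        (h1.pow_const 2)).div (h2.const_add 1) |>.div_const _).exp.div (h2.const_add 1).sqrt
    have hMm : ∀ i ≤ L, Measurable[𝒢 i] (M i) := fun i hi => by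
      refine Finset.measurable_prod _ fun j hj => ?_
      have hj := Finset.mem_range.1 hj
      exact ((hDm j (hj.trans_le hi)).mono (𝒢.mono hj) le_rfl).ennreal_ofReal
    have hmax := mul_measure_exists_le_le_one (P := P) 𝒢 (M := M) (L := L)
      (fun ω => by simp [hM]) hMm (fun i hi A hA => by
        have h1 := lintegral_mul_mixture_le (𝒢.le i) hR ((hZm i hi).mono (𝒢.le _) le_rfl) (hZ i hi)
          ((hMm i hi.le).indicator hA) (ha i hi) (hu i hi) (hu0 i)
        rw [← lintegral_indicator (𝒢.le i _ hA), ← lintegral_indicator (𝒢.le i _ hA)]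
        refine le_trans (le_of_eq (lintegral_congr fun ω => ?_)) h1
        by_cases hω : ω ∈ A
        · simp only [Set.indicator_of_mem hω, hM, Finset.prod_range_succ, hD]
        · simp [Set.indicator_of_notMem hω])
      (ENNReal.ofReal (1 / δ))
    have hle : P {ω | ∃ i ≤ L, ENNReal.ofReal (1 / δ) ≤ M i ω} ≤ ENNReal.ofReal δ := by
      calc _ = ENNReal.ofReal δ * (ENNReal.ofReal (1 / δ) *
            P {ω | ∃ i ≤ L, ENNReal.ofReal (1 / δ) ≤ M i ω}) := by
            rw [← mul_assoc, ← ENNReal.ofReal_mul hδ.le, mul_one_div_cancel hδ.ne',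
              ENNReal.ofReal_one, one_mul]
        _ ≤ ENNReal.ofReal δ * 1 := by gcongr
        _ = _ := mul_one _
    refine le_trans (measure_mono ?_) hle
    rintro ω ⟨i, hi, h⟩
    refine ⟨i, hi, ?_⟩
    rw [hM]
    simp only
    rw [← ENNReal.ofReal_prod_of_nonneg fun j _ => (hDpos j ω).le]
    refine ENNReal.ofReal_le_ofReal ?_
    rw [← Real.log_le_log_iff (by positivity) (Finset.prod_pos fun j _ => hDpos j ω),
      Real.log_prod fun j _ => (hDpos j ω).ne']
    have hlogD : ∀ j, Real.log (D j ω) =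
        (2 * a j ω * Z j ω + u j ω * Z j ω ^ 2 - a j ω ^ 2) / (1 + u j ω) / (2 * R ^ 2) -
          Real.log (1 + u j ω) / 2 := fun j => by
      have := hu0 j ω
      rw [hD, Real.log_div (Real.exp_pos _).ne' (by positivity), Real.log_exp,
        Real.log_sqrt (by linarith)]
    simp_rw [hlogD]
    rw [Finset.sum_sub_distrib, ← Finset.sum_div, ← Finset.sum_div]
    have h2 : 0 < R ^ 2 := by positivity
    have h3 : (2 * Real.log (1 / δ) + ∑ j ∈ Finset.range i, Real.log (1 + u j ω)) / 2 ≤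
      (∑ j ∈ Finset.range i, (2 * a j ω * Z j ω + u j ω * Z j ω ^ 2 - a j ω ^ 2) /
        (1 + u j ω)) / (2 * R ^ 2) := by
      rw [div_le_div_iff₀ two_pos (by positivity)]
      linarith
    linarith

end Maximal

/-! ### Sums along a sampling sequence -/

section Sequences

variable {X E : Type*} [NormedAddCommGroup E] [InnerProductSpace ℝ E]
variable {φ : X → E} {k : X → X → ℝ} {lam : ℝ}

theorem selfNormalizedSq_eq_sum (hk : ∀ x y, k x y = inner ℝ (φ x) (φ y)) (hlam : 0 < lam)
    (a : ℕ → X) (y : ℕ → ℝ) (m : ℕ) :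
    selfNormalizedSq k lam (fun i : Fin m => a i) (fun i => y i) = ∑ j ∈ Finset.range m,
      (2 * postMean k lam (fun i : Fin j => a i) (fun i => y i) (a j) * y j +
        postVar k lam (fun i : Fin j => a i) (a j) / lam * y j ^ 2 -
        postMean k lam (fun i : Fin j => a i) (fun i => y i) (a j) ^ 2) /
      (1 + postVar k lam (fun i : Fin j => a i) (a j) / lam) := by
  induction m with
  | zero => simp [selfNormalizedSq]
  | succ m ih =>
    rw [Finset.sum_range_succ, ← ih]
    exact selfNormalizedSq_succ hk hlam (fun i : Fin (m + 1) => a i) (fun i => y i)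

theorem log_det_eq_sum (hk : ∀ x y, k x y = inner ℝ (φ x) (φ y)) (hlam : 0 < lam)
    (a : ℕ → X) (m : ℕ) :
    Real.log (1 + lam⁻¹ • gramMatrix k (fun i : Fin m => a i)).det = ∑ j ∈ Finset.range m,
      Real.log (1 + postVar k lam (fun i : Fin j => a i) (a j) / lam) := by
  induction m with
  | zero => simp
  | succ m ih =>
    rw [Finset.sum_range_succ, ← ih]
    exact log_det_succ hk hlam (fun i : Fin (m + 1) => a i)

/-- The posterior variances at the points as they are sampled are summable against the information
gain, by `y / (1 + y) ≤ log (1 + y)`. -/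
theorem sum_postVar_le [Finite X] (hk : ∀ x y, k x y = inner ℝ (φ x) (φ y)) (hlam : 0 < lam)
    (hk1 : ∀ z, k z z ≤ 1) (a : ℕ → X) (m : ℕ) :
    ∑ j ∈ Finset.range m, postVar k lam (fun i : Fin j => a i) (a j) ≤
      2 * (1 + lam) * infoGain k lam m := by
  have h1 := le_infoGain k lam (fun i : Fin m => a i)
  rw [log_det_eq_sum hk hlam] at h1
  have h2 : ∀ j ∈ Finset.range m, postVar k lam (fun i : Fin j => a i) (a j) ≤
      (1 + lam) * Real.log (1 + postVar k lam (fun i : Fin j => a i) (a j) / lam) := fun j _ => by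
    have h0 := postVar_nonneg hk hlam (fun i : Fin j => a i) (a j)
    have h3 := (postVar_le hk hlam (fun i : Fin j => a i) (a j)).trans (hk1 _)
    set v := postVar k lam (fun i : Fin j => a i) (a j)
    have h4 := Real.one_sub_inv_le_log_of_pos (show 0 < 1 + v / lam by positivity)
    have h5 : v / (1 + lam) ≤ 1 - (1 + v / lam)⁻¹ := by
      have : 1 - (1 + v / lam)⁻¹ = v / (v + lam) := by field_simp; ring
      rw [this]
      gcongr
    rw [← div_le_iff₀' (by positivity)]
    exact h5.trans h4
  calc _ ≤ ∑ j ∈ Finset.range m,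
        (1 + lam) * Real.log (1 + postVar k lam (fun i : Fin j => a i) (a j) / lam) :=
        Finset.sum_le_sum h2
    _ ≤ _ := by
        rw [← Finset.mul_sum]
        nlinarith

end Sequences

/-! ### Concentration of the posterior mean of the noise -/

section Concentration

open scoped ENNReal

theorem measurable_comp_of_finite {Ω X β : Type*} [Finite X] [MeasurableSpace Ω]
    [MeasurableSpace β] {n : ℕ} {x : Fin n → Ω → X}
    (hx : ∀ i z, MeasurableSet {ω | x i ω = z}) (F : (Fin n → X) → β) :
    Measurable fun ω => F fun i => x i ω := by
  intro S _
  have : (fun ω => F fun i => x i ω) ⁻¹' S = ⋃ v ∈ F ⁻¹' S, ⋂ i, {ω | x i ω = v i} := by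
    ext ω
    simp only [Set.mem_preimage, Set.mem_iUnion, Set.mem_iInter, Set.mem_ofPred_eq, exists_prop]
    refine ⟨fun h => ⟨_, h, fun _ => rfl⟩, fun ⟨v, hv, h⟩ => ?_⟩
    rwa [funext h]
  rw [this]
  exact MeasurableSet.biUnion (Set.to_countable _) fun v _ =>
    MeasurableSet.iInter fun i => hx i _

variable {X E Ω : Type*} [NormedAddCommGroup E] [InnerProductSpace ℝ E]
variable {φ : X → E} {k : X → X → ℝ} {lam R δ : ℝ}
variable {mΩ : MeasurableSpace Ω} {P : Measure Ω} {ℱ : Filtration ℕ mΩ}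
variable {T : ℕ} {Z : ℕ → Ω → ℝ} {x : ℕ → Ω → X}

/-- Self-normalized concentration of the noise observed from slot `s + 1` on, uniformly over the
number of observations. -/
theorem measure_exists_selfNormalizedSq_gt_le [Finite X] [IsProbabilityMeasure P]
    (hk : ∀ x y, k x y = inner ℝ (φ x) (φ y)) (hlam : 0 < lam) (hR : 0 ≤ R) (hδ : 0 < δ)
    (hZ : IsNoise ℱ P R T Z)
    (hx : ∀ t ∈ Finset.Icc 1 T, ∀ z : X, MeasurableSet[ℱ (t - 1)] {ω | x t ω = z})
    {s L : ℕ} (hsL : s + L ≤ T) :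
    P {ω | ∃ i ≤ L, R ^ 2 * (2 * Real.log (1 / δ) +
        Real.log (1 + lam⁻¹ • gramMatrix k (fun j : Fin i => x (s + 1 + j) ω)).det) <
      selfNormalizedSq k lam (fun j : Fin i => x (s + 1 + j) ω)
        (fun j => Z (s + 1 + j) ω)} ≤ ENNReal.ofReal δ := by
  let 𝒢 : Filtration ℕ mΩ :=
    ⟨fun i => ℱ (s + i), fun i j hij => ℱ.mono (Nat.add_le_add_left hij s), fun i => ℱ.le _⟩
  have hx' : ∀ i < L, ∀ j ≤ i, ∀ z, MeasurableSet[𝒢 i] {ω | x (s + 1 + j) ω = z} :=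
    fun i hi j hj z => by
      have h1 := hx (s + 1 + j) (Finset.mem_Icc.2 ⟨by omega, by omega⟩) z
      exact ℱ.mono (show s + 1 + j - 1 ≤ s + i by omega) _ h1
  have hZ' : ∀ i < L, Measurable[𝒢 (i + 1)] (Z (s + 1 + i)) ∧
      CondSubGaussian (𝒢 i) P R (Z (s + 1 + i)) := fun i hi => by
    have h1 := hZ (s + 1 + i) (Finset.mem_Icc.2 ⟨by omega, by omega⟩)
    have h2 : s + 1 + i - 1 = s + i := by omega
    rw [h2] at h1
    exact ⟨h1.1.mono (ℱ.mono (show s + 1 + i ≤ s + (i + 1) by omega)) le_rfl, h1.2⟩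
  have hpt : ∀ i < L, ∀ F : (Fin (i + 1) → X) → ℝ,
      Measurable[𝒢 i] fun ω => F fun j => x (s + 1 + j) ω := fun i hi F =>
    @measurable_comp_of_finite _ _ _ _ (𝒢 i) _ _ _
      (fun j z => hx' i hi j (Nat.lt_succ_iff.1 j.2) z) F
  have key := measure_exists_selfNormalized_gt_le (P := P) 𝒢 (L := L) hR hδ
    (a := fun i ω => postMean k lam (fun j : Fin i => x (s + 1 + j) ω)
      (fun j => Z (s + 1 + j) ω) (x (s + 1 + i) ω))
    (u := fun i ω => postVar k lam (fun j : Fin i => x (s + 1 + j) ω) (x (s + 1 + i) ω) / lam)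
    (Z := fun i => Z (s + 1 + i))
    (fun i hi => by
      simp only [postMean_eq_postWeights_dotProduct hk hlam, dotProduct]
      refine Finset.measurable_sum _ fun j _ => Measurable.mul ?_ ?_
      · exact hpt i hi fun v => postWeights k lam (Fin.init v) (v (Fin.last i)) j
      · exact ((hZ' j (j.2.trans hi)).1).mono (𝒢.mono j.2) le_rfl)
    (fun i hi => hpt i hi fun v => postVar k lam (Fin.init v) (v (Fin.last i)) / lam)
    (fun i ω => div_nonneg (postVar_nonneg hk hlam _ _) hlam.le)
    (fun i hi => (hZ' i hi).1) (fun i hi => (hZ' i hi).2)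
  refine le_trans (le_of_eq ?_) key
  congr 1
  ext ω
  simp only [Set.mem_ofPred_eq]
  refine exists_congr fun i => and_congr Iff.rfl ?_
  rw [selfNormalizedSq_eq_sum hk hlam (fun j => x (s + 1 + j) ω) (fun j => Z (s + 1 + j) ω),
    log_det_eq_sum hk hlam (fun j => x (s + 1 + j) ω)]

theorem abs_postMean_le_of_selfNormalizedSq_le [Finite X]
    (hk : ∀ x y, k x y = inner ℝ (φ x) (φ y)) (hlam : 0 < lam) (hR : 0 ≤ R)
    {m : ℕ} (a : Fin m → X) (y : Fin m → ℝ)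
    (h : selfNormalizedSq k lam a y ≤ R ^ 2 * (2 * Real.log (1 / δ) +
        Real.log (1 + lam⁻¹ • gramMatrix k a).det)) (z : X) :
    |postMean k lam a y z| ≤
      1 / √lam * R * √(2 * Real.log (1 / δ) + 2 * infoGain k lam m) * √(postVar k lam a z) := by
  have h0 := postVar_nonneg hk hlam a z
  have h1 : selfNormalizedSq k lam a y ≤
      R ^ 2 * (2 * Real.log (1 / δ) + 2 * infoGain k lam m) := by
    refine h.trans (mul_le_mul_of_nonneg_left ?_ (sq_nonneg R))
    linarith [le_infoGain k lam a]
  have h2 : postMean k lam a y z ^ 2 ≤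
      postVar k lam a z / lam * (R ^ 2 * (2 * Real.log (1 / δ) + 2 * infoGain k lam m)) :=
    (postMean_sq_le hk hlam a y z).trans (mul_le_mul_of_nonneg_left h1 (by positivity))
  refine (Real.abs_le_sqrt h2).trans (le_of_eq ?_)
  rw [Real.sqrt_mul (by positivity), Real.sqrt_mul (sq_nonneg R), Real.sqrt_sq hR,
    Real.sqrt_div h0]
  ring

end Concentration

/-! ### Confidence bounds under drift -/

section Variation

variable {H : Type*} [NormedAddCommGroup H]

/-- Variation of a sequence of vectors from slot `s` to slot `t`. -/
noncomputable def pathVariation (f : ℕ → H) (s t : ℕ) : ℝ := ∑ i ∈ Finset.Ico s t, ‖f (i + 1) - f i‖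

theorem pathVariation_nonneg (f : ℕ → H) (s t : ℕ) : 0 ≤ pathVariation f s t :=
  Finset.sum_nonneg fun _ _ => norm_nonneg _

theorem norm_sub_le_pathVariation (f : ℕ → H) {s i t : ℕ} (hsi : s ≤ i) (hit : i ≤ t) :
    ‖f i - f t‖ ≤ pathVariation f s t := by
  have h1 : ‖f i - f t‖ ≤ pathVariation f i t := by
    rw [norm_sub_rev, ← Finset.sum_Ico_sub f hit]
    exact norm_sum_le _ _
  exact h1.trans (Finset.sum_le_sum_of_subset_of_nonneg (Finset.Ico_subset_Ico_left hsi)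
    fun _ _ _ => norm_nonneg _)

end Variation

section Confidence

variable {X H Ω : Type*} [NormedAddCommGroup H] [InnerProductSpace ℝ H] [CompleteSpace H]
  [RKHS ℝ H X ℝ]

theorem scalarKernel_eq_inner (x y : X) :
    scalarKernel H x y = inner ℝ (RKHS.kerFun H x (1 : ℝ)) (RKHS.kerFun H y (1 : ℝ)) := by
  rw [real_inner_comm, ← RKHS.kernel_inner]
  simp [scalarKernel]

theorem inner_kerFun_one (f : H) (z : X) : inner ℝ (RKHS.kerFun H z (1 : ℝ)) f = f z := by
  simp

theorem abs_apply_le_norm (hk1 : ∀ z : X, scalarKernel H z z ≤ 1) (f : H) (z : X) :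
    |f z| ≤ ‖f‖ := by
  have h1 : ‖RKHS.kerFun H z (1 : ℝ)‖ ≤ 1 := by
    have := hk1 z
    rw [scalarKernel_eq_inner, real_inner_self_eq_norm_sq] at this
    exact (sq_le_one_iff₀ (norm_nonneg _)).1 this
  rw [← inner_kerFun_one]
  exact (abs_real_inner_le_norm _ _).trans (mul_le_of_le_one_left (norm_nonneg _) h1)

/-- Observations which are off by at most `D` shift the posterior mean by at most `√(m / λ) D`,
since the weights have squared norm at most `1 / λ`. -/
theorem abs_postMean_le_of_abs_le {lam : ℝ} (hlam : 0 < lam)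
    (hk1 : ∀ z : X, scalarKernel H z z ≤ 1) {m : ℕ} (a : Fin m → X) (y : Fin m → ℝ) (z : X)
    {D : ℝ} (hy : ∀ i, |y i| ≤ D) (hD : 0 ≤ D) :
    |postMean (scalarKernel H) lam a y z| ≤ √(m / lam) * D := by
  rw [postMean_eq_postWeights_dotProduct scalarKernel_eq_inner hlam]
  have h1 := (mul_dotProduct_postWeights_self_le (scalarKernel_eq_inner (H := H)) hlam a z).trans
    (hk1 z)
  set α := postWeights (scalarKernel H) lam a z
  have h2 : (α ⬝ᵥ y) ^ 2 ≤ (m / lam) * D ^ 2 := by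
    have h3 : (α ⬝ᵥ y) ^ 2 ≤ (α ⬝ᵥ α) * (y ⬝ᵥ y) := by
      have := Finset.sum_mul_sq_le_sq_mul_sq Finset.univ α y
      simpa [dotProduct, sq] using this
    have h4 : y ⬝ᵥ y ≤ m * D ^ 2 := by
      have : ∀ i ∈ Finset.univ, y i * y i ≤ D ^ 2 := fun i _ => by
        rw [← sq, ← sq_abs]
        exact pow_le_pow_left₀ (abs_nonneg _) (hy i) 2
      simpa [dotProduct] using Finset.sum_le_sum this
    have h5 : α ⬝ᵥ α ≤ 1 / lam := by rwa [le_div_iff₀' hlam]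
    calc _ ≤ (α ⬝ᵥ α) * (y ⬝ᵥ y) := h3
      _ ≤ 1 / lam * (m * D ^ 2) :=
        mul_le_mul h5 h4 (dotProduct_self_real_nonneg y) (by positivity)
      _ = _ := by ring
  refine (Real.abs_le_sqrt h2).trans (le_of_eq ?_)
  rw [Real.sqrt_mul (by positivity), Real.sqrt_sq hD]

namespace RestartParams

variable {p : RestartParams}

theorem start_le {t : ℕ} (ht : 1 ≤ t) : p.start t ≤ t := by
  have := Nat.div_mul_le_self (t - 1) p.W
  unfold start
  omega

theorem start_add_age {t : ℕ} (ht : 1 ≤ t) : p.start t + p.age t = t := by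
  have := start_le (p := p) ht
  unfold age
  omega

theorem age_lt {t : ℕ} (ht : 1 ≤ t) (hW : 1 ≤ p.W) : p.age t < p.W := by
  have h1 := start_add_age (p := p) ht
  have h2 := Nat.div_add_mod (t - 1) p.W
  have h3 := Nat.mod_lt (t - 1) hW
  have h4 : p.start t = p.W * ((t - 1) / p.W) + 1 := by rw [start, mul_comm]
  omega

/-- A confidence bound for a function that drifts: on the event that the noise of the window is
well behaved, the error is at most the stationary confidence width plus the drift in the window. -/
theorem abs_sub_mean_le [Finite X] (hlam : 0 < p.lam) (hR : 0 ≤ p.R)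
    (hk1 : ∀ z : X, scalarKernel H z z ≤ 1) {f : ℕ → H} {B : ℝ} {t : ℕ} (ht : 1 ≤ t)
    (hf : ‖f t‖ ≤ B) (x : ℕ → X) (n : ℕ → ℝ)
    (h : selfNormalizedSq (scalarKernel H) p.lam (fun j : Fin (p.age t) => x (p.start t + j))
        (fun j => n (p.start t + j)) ≤ p.R ^ 2 * (2 * Real.log (1 / p.delta) +
        Real.log (1 + p.lam⁻¹ • gramMatrix (scalarKernel H)
          (fun j : Fin (p.age t) => x (p.start t + j))).det)) (z : X) :
    |f t z - p.mean (scalarKernel H) x (fun i => f i (x i) + n i) t z| ≤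
      p.width (scalarKernel H) B t * p.sd (scalarKernel H) x t z +
        √(p.age t / p.lam) * pathVariation f (p.start t) t := by
  have hk := scalarKernel_eq_inner (H := H) (X := X)
  set k := scalarKernel H (X := X) with hkdef
  set a : Fin (p.age t) → X := fun j => x (p.start t + j) with ha
  have h1 := abs_postMean_le_of_selfNormalizedSq_le hk hlam hR _ _ h z
  have h2 := abs_sub_postMean_le hk hlam a z (f t)
  simp only [inner_kerFun_one] at h2
  have h3 := abs_postMean_le_of_abs_le hlam hk1 a
    (fun j => f (p.start t + j) (a j) - f t (a j)) z (D := pathVariation f (p.start t) t)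
    (fun j => by
      have h4 := abs_apply_le_norm hk1 (f (p.start t + j) - f t) (a j)
      rw [RKHS.coe_sub, Pi.sub_apply] at h4
      refine h4.trans (norm_sub_le_pathVariation f (Nat.le_add_right _ _) ?_)
      have := start_add_age (p := p) ht
      have := j.2
      omega) (pathVariation_nonneg _ _ _)
  have hsplit : p.mean k x (fun i => f i (x i) + n i) t z =
      postMean k p.lam a (fun j => f t (a j)) z +
      postMean k p.lam a (fun j => f (p.start t + j) (a j) - f t (a j)) z +
      postMean k p.lam a (fun j => n (p.start t + j)) z := by
    simp only [mean, postMean_eq_postWeights_dotProduct hk hlam, ← dotProduct_add]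
    congr 1
    ext j
    simp only [Pi.add_apply, ha]
    ring
  have h5 : ‖f t‖ * √(postVar k p.lam a z) ≤ B * √(postVar k p.lam a z) :=
    mul_le_mul_of_nonneg_right hf (Real.sqrt_nonneg _)
  rw [hsplit, width, sd, add_mul]
  rw [abs_le] at h1 h2 h3 ⊢
  constructor <;> linarith [h1.1, h1.2, h2.1, h2.2, h3.1, h3.2]

theorem measure_not_confident_le [Finite X] {mΩ : MeasurableSpace Ω} {P : Measure Ω}
    [IsProbabilityMeasure P] {ℱ : Filtration ℕ mΩ} {T : ℕ} {n : ℕ → Ω → ℝ} {x : ℕ → Ω → X}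
    (hlam : 0 < p.lam) (hR : 0 ≤ p.R) (hδ : 0 < p.delta) (hW : 1 ≤ p.W)
    (hk1 : ∀ z : X, scalarKernel H z z ≤ 1) {f : ℕ → H} {B : ℝ}
    (hf : ∀ t ∈ Finset.Icc 1 T, ‖f t‖ ≤ B) (hn : IsNoise ℱ P p.R T n)
    (hx : ∀ t ∈ Finset.Icc 1 T, ∀ z : X, MeasurableSet[ℱ (t - 1)] {ω | x t ω = z}) :
    P {ω | ∃ t ∈ Finset.Icc 1 T, ∃ z, p.width (scalarKernel H) B t *
          p.sd (scalarKernel H) (fun i => x i ω) t z +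
          √(p.age t / p.lam) * pathVariation f (p.start t) t <
        |f t z - p.mean (scalarKernel H) (fun i => x i ω)
          (fun i => f i (x i ω) + n i ω) t z|} ≤
      ENNReal.ofReal (⌈(T : ℝ) / p.W⌉₊ * p.delta) := by
  set bad : ℕ → Set Ω := fun j => {ω | ∃ i ≤ T - j * p.W,
      p.R ^ 2 * (2 * Real.log (1 / p.delta) + Real.log (1 + p.lam⁻¹ •
        gramMatrix (scalarKernel H) (fun l : Fin i => x (j * p.W + 1 + l) ω)).det) <
      selfNormalizedSq (scalarKernel H) p.lam (fun l : Fin i => x (j * p.W + 1 + l) ω)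
        (fun l => n (j * p.W + 1 + l) ω)} with hbad
  have hWr : (0 : ℝ) < p.W := by exact_mod_cast hW
  have hlt : ∀ j ∈ Finset.range ⌈(T : ℝ) / p.W⌉₊, j * p.W ≤ T := fun j hj => by
    have h1 := Nat.lt_ceil.1 (Finset.mem_range.1 hj)
    rw [lt_div_iff₀ hWr] at h1
    exact_mod_cast h1.le
  calc _ ≤ P (⋃ j ∈ Finset.range ⌈(T : ℝ) / p.W⌉₊, bad j) := by
        refine measure_mono ?_
        rintro ω ⟨t, ht, z, htz⟩
        have ht' := Finset.mem_Icc.1 ht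
        have h1 := Nat.div_mul_le_self (t - 1) p.W
        refine Set.mem_biUnion (x := (t - 1) / p.W) ?_ ?_
        · simp only [Finset.coe_range, Set.mem_Iio]
          rw [Nat.lt_ceil, lt_div_iff₀ hWr]
          exact_mod_cast (show (t - 1) / p.W * p.W < T by omega)
        · by_contra hcon
          have h2 := start_add_age (p := p) ht'.1
          have h3 : p.start t = (t - 1) / p.W * p.W + 1 := rfl
          simp only [hbad, Set.mem_ofPred_eq, not_exists, not_and, not_lt] at hcon
          exact absurd htz (not_lt.2 (abs_sub_mean_le hlam hR hk1 ht'.1 (hf t ht)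
            (fun i => x i ω) (fun i => n i ω) (hcon (p.age t) (by omega)) z))
    _ ≤ ∑ j ∈ Finset.range ⌈(T : ℝ) / p.W⌉₊, P (bad j) := measure_biUnion_finset_le _ _
    _ ≤ ∑ j ∈ Finset.range ⌈(T : ℝ) / p.W⌉₊, ENNReal.ofReal p.delta := by
        refine Finset.sum_le_sum fun j hj => ?_
        refine measure_exists_selfNormalizedSq_gt_le scalarKernel_eq_inner hlam hR hδ hn hx ?_
        have := hlt j hj
        omega
    _ = _ := by
        rw [Finset.sum_const, Finset.card_range, nsmul_eq_mul,
          ENNReal.ofReal_mul (Nat.cast_nonneg _), ENNReal.ofReal_natCast]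

end RestartParams

end Confidence

/-! ### The primal-dual iteration -/

section Policy

variable {X : Type*} [Fintype X]

theorem policyMean_mono {π f g : X → ℝ} (hπ : π ∈ stdSimplex ℝ X) (h : ∀ z, f z ≤ g z) :
    policyMean π f ≤ policyMean π g :=
  Finset.sum_le_sum fun z _ => mul_le_mul_of_nonneg_left (h z) (hπ.1 z)

theorem policyMean_add_const {π : X → ℝ} (hπ : π ∈ stdSimplex ℝ X) (f : X → ℝ) (e : ℝ) :
    policyMean π (fun z => f z + e) = policyMean π f + e := by
  simp only [policyMean, mul_add, Finset.sum_add_distrib, ← Finset.sum_mul, hπ.2, one_mul]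

theorem policyMean_sub_mul (π f g : X → ℝ) (c : ℝ) :
    policyMean π (fun z => f z - c * g z) = policyMean π f - c * policyMean π g := by
  simp only [policyMean, mul_sub, Finset.sum_sub_distrib, Finset.mul_sum]
  congr 1
  exact Finset.sum_congr rfl fun z _ => by ring

theorem policyMean_const {π : X → ℝ} (hπ : π ∈ stdSimplex ℝ X) (e : ℝ) :
    policyMean π (fun _ => e) = e := by
  simp only [policyMean, ← Finset.sum_mul, hπ.2, one_mul]

end Policy

section PrimalDual

variable {X : Type*}

theorem clip_le {a b v : ℝ} (hab : a ≤ b) : clip a b v ≤ b := max_le hab (min_le_left _ _)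

theorem le_clip (a b v : ℝ) : a ≤ clip a b v := le_max_left _ _

theorem clip_zero_sq_le (b v : ℝ) : clip 0 b v ^ 2 ≤ v ^ 2 := by
  rw [sq_le_sq, abs_of_nonneg (le_clip 0 b v), clip]
  exact max_le (abs_nonneg _) ((min_le_right _ _).trans (le_abs_self _))

/-- The primal-dual iteration seen from outside the estimation problem: true functions `f t`, `g t`,
optimistic estimates `fh t`, `gh t` with optimism errors `e t`, `e' t`, projected dual ascent with
variable `φ`, and actions `x t` maximizing the estimated Lagrangian. -/
structure PrimalDualRun (f g fh gh : ℕ → X → ℝ) (e e' φ : ℕ → ℝ) (x : ℕ → X) (B G ρ η : ℝ)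
    (T : ℕ) : Prop where
  reward_mem : ∀ t ∈ Finset.Icc 1 T, ∀ z, -B ≤ fh t z ∧ fh t z ≤ B
  constraint_mem : ∀ t ∈ Finset.Icc 1 T, ∀ z, -G ≤ gh t z ∧ gh t z ≤ G
  reward_optimistic : ∀ t ∈ Finset.Icc 1 T, ∀ z, f t z ≤ fh t z + e t
  constraint_optimistic : ∀ t ∈ Finset.Icc 1 T, ∀ z, gh t z ≤ g t z + e' t
  error_nonneg : ∀ t ∈ Finset.Icc 1 T, 0 ≤ e' t
  dual_one : φ 1 = 0
  dual_succ : ∀ t ∈ Finset.Icc 1 T, φ (t + 1) = clip 0 ρ (φ t + η * gh t (x t))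
  maximizes : ∀ t ∈ Finset.Icc 1 T, ∀ z,
    fh t z - φ t * gh t z ≤ fh t (x t) - φ t * gh t (x t)

namespace PrimalDualRun

variable {f g fh gh : ℕ → X → ℝ} {e e' φ : ℕ → ℝ} {x : ℕ → X} {B G ρ η : ℝ} {T : ℕ}

theorem dual_mem (h : PrimalDualRun f g fh gh e e' φ x B G ρ η T) (hρ : 0 ≤ ρ) {t : ℕ}
    (ht : t ∈ Finset.Icc 1 (T + 1)) : 0 ≤ φ t ∧ φ t ≤ ρ := by
  obtain ⟨h1, h2⟩ := Finset.mem_Icc.1 ht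
  rcases h1.eq_or_lt with rfl | h1
  · rw [h.dual_one]; exact ⟨le_rfl, hρ⟩
  · obtain ⟨s, rfl⟩ := Nat.exists_eq_add_of_le' h1.le
    rw [h.dual_succ s (Finset.mem_Icc.2 ⟨by omega, by omega⟩)]
    exact ⟨le_clip _ _ _, clip_le hρ⟩

variable [Fintype X]

theorem policyMean_le (h : PrimalDualRun f g fh gh e e' φ x B G ρ η T) {t : ℕ}
    (ht : t ∈ Finset.Icc 1 T) {π : X → ℝ} (hπ : π ∈ stdSimplex ℝ X) :
    policyMean π (fh t) - φ t * policyMean π (gh t) ≤ fh t (x t) - φ t * gh t (x t) := by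
  rw [← policyMean_sub_mul, ← policyMean_const hπ (fh t (x t) - φ t * gh t (x t))]
  exact policyMean_mono hπ (h.maximizes t ht)

theorem regret_le (h : PrimalDualRun f g fh gh e e' φ x B G ρ η T) (hρ : 0 ≤ ρ) (hη : 0 < η)
    {w : ℕ → ℝ} (hw : ∀ t ∈ Finset.Icc 1 T, fh t (x t) ≤ f t (x t) + w t)
    {πs : ℕ → X → ℝ} (hπ : ∀ t ∈ Finset.Icc 1 T, πs t ∈ stdSimplex ℝ X)
    (hπg : ∀ t ∈ Finset.Icc 1 T, policyMean (πs t) (g t) ≤ 0) :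
    dynRegret f πs T x ≤ T * (η * G ^ 2 / 2) + ∑ t ∈ Finset.Icc 1 T, (e t + ρ * e' t + w t) := by
  have hstep : ∀ t ∈ Finset.Icc 1 T, policyMean (πs t) (f t) - f t (x t) ≤
      (φ t ^ 2 - φ (t + 1) ^ 2) / (2 * η) + η * G ^ 2 / 2 + (e t + ρ * e' t + w t) := by
    intro t ht
    obtain ⟨hφ0, hφρ⟩ := h.dual_mem hρ (Finset.Icc_subset_Icc_right (Nat.le_succ T) ht)
    have h1 := h.policyMean_le ht (hπ t ht)
    have h2 := policyMean_mono (hπ t ht) (h.reward_optimistic t ht)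
    have h3 := policyMean_mono (hπ t ht) (h.constraint_optimistic t ht)
    rw [policyMean_add_const (hπ t ht)] at h2 h3
    have h4 : φ t * policyMean (πs t) (gh t) ≤ ρ * e' t := by
      have h5 : policyMean (πs t) (gh t) ≤ e' t := by linarith [hπg t ht]
      exact (mul_le_mul_of_nonneg_left h5 hφ0).trans
        (mul_le_mul_of_nonneg_right hφρ (h.error_nonneg t ht))
    have h6 : -(φ t * gh t (x t)) ≤ (φ t ^ 2 - φ (t + 1) ^ 2) / (2 * η) + η * G ^ 2 / 2 := by
      have h7 : φ (t + 1) ^ 2 ≤ (φ t + η * gh t (x t)) ^ 2 := by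
        rw [h.dual_succ t ht]; exact clip_zero_sq_le _ _
      have h8 : gh t (x t) ^ 2 ≤ G ^ 2 :=
        sq_le_sq' (h.constraint_mem t ht _).1 (h.constraint_mem t ht _).2
      have h9 : (φ t ^ 2 - φ (t + 1) ^ 2) / (2 * η) + η * G ^ 2 / 2 =
          (φ t ^ 2 - φ (t + 1) ^ 2 + η ^ 2 * G ^ 2) / (2 * η) := by field_simp
      rw [h9, le_div_iff₀ (by positivity)]
      nlinarith [mul_le_mul_of_nonneg_left h8 (sq_nonneg η)]
    linarith [hw t ht]
  have htel : ∑ t ∈ Finset.Icc 1 T, (φ t ^ 2 - φ (t + 1) ^ 2) / (2 * η) ≤ 0 := by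
    rw [← Finset.sum_div, ← Finset.Ico_add_one_right_eq_Icc,
      ← neg_neg (∑ t ∈ Finset.Ico 1 (T + 1), (φ t ^ 2 - φ (t + 1) ^ 2)), ← Finset.sum_neg_distrib]
    simp only [neg_sub]
    rw [Finset.sum_Ico_sub (fun t => φ t ^ 2) (by omega), h.dual_one]
    apply div_nonpos_of_nonpos_of_nonneg _ (by positivity)
    nlinarith [sq_nonneg (φ (T + 1))]
  have hsum := Finset.sum_le_sum hstep
  rw [Finset.sum_add_distrib, Finset.sum_add_distrib, Finset.sum_const, Nat.card_Icc,
    nsmul_eq_mul, Nat.add_sub_cancel] at hsum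
  rw [dynRegret, ← Finset.sum_sub_distrib]
  linarith

/-- The estimated violation. While the dual variable is not cut off at `ρ` it dominates the
accumulated estimated violation. It can be cut off only when it exceeds `ρ / 2`; then the Slater
policy gains more on the constraint than it can lose on the reward, so that the estimate at the
maximizer is at most the optimism error. -/
theorem sum_constraint_le (h : PrimalDualRun f g fh gh e e' φ x B G ρ η T) (hρ : 0 < ρ)
    (hη : 0 < η) (hηG : η * G ≤ ρ / 2) {τ : ℝ} (hτ : 0 < τ) (hτρ : 4 * B / τ ≤ ρ)
    (hslater : ∀ t ∈ Finset.Icc 1 T, ∃ π ∈ stdSimplex ℝ X, policyMean π (g t) ≤ -τ) :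
    ∑ t ∈ Finset.Icc 1 T, gh t (x t) ≤ ρ / η + ∑ t ∈ Finset.Icc 1 T, e' t := by
  have hstep : ∀ t ∈ Finset.Icc 1 T, gh t (x t) ≤ (φ (t + 1) - φ t) / η + e' t := by
    intro t ht
    obtain ⟨hφ0, hφρ⟩ := h.dual_mem hρ.le (Finset.Icc_subset_Icc_right (Nat.le_succ T) ht)
    have he := h.error_nonneg t ht
    have hgoal : φ t + η * gh t (x t) - η * e' t ≤ φ (t + 1) := by
      rw [h.dual_succ t ht, clip]
      rcases le_or_gt (φ t + η * gh t (x t)) ρ with hle | hgt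
      · rw [min_eq_right hle]
        have := le_max_right 0 (φ t + η * gh t (x t))
        nlinarith
      · rw [min_eq_left hgt.le, max_eq_right hρ.le]
        have hφ2 : ρ / 2 < φ t := by
          have := mul_le_mul_of_nonneg_left (h.constraint_mem t ht (x t)).2 hη.le
          linarith
        have hghe : gh t (x t) ≤ e' t := by
          obtain ⟨π, hπ, hπg⟩ := hslater t ht
          have h1 := h.policyMean_le ht hπ
          have h2 := policyMean_mono hπ fun z => (h.reward_mem t ht z).1
          have h3 := policyMean_mono hπ (h.constraint_optimistic t ht)
          rw [policyMean_const hπ] at h2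
          rw [policyMean_add_const hπ] at h3
          have h4 := (h.reward_mem t ht (x t)).2
          have h5 : 2 * B ≤ φ t * τ := by
            rw [div_le_iff₀ hτ] at hτρ
            nlinarith
          have h6 := mul_le_mul_of_nonneg_left (h3.trans (add_le_add_left hπg (e' t))) hφ0
          have hφpos : 0 < φ t := by linarith
          refine le_of_mul_le_mul_left ?_ hφpos
          linarith
        have := mul_le_mul_of_nonneg_left hghe hη.le
        linarith
    have h1 : (φ (t + 1) - φ t) / η + e' t = (φ (t + 1) - φ t + η * e' t) / η := by
      field_simp
    rw [h1, le_div_iff₀ hη]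
    linarith
  have hsum := Finset.sum_le_sum hstep
  rw [Finset.sum_add_distrib, ← Finset.sum_div, ← Finset.Ico_add_one_right_eq_Icc,
    Finset.sum_Ico_sub φ (by omega : 1 ≤ T + 1), h.dual_one, sub_zero] at hsum
  rw [← Finset.Ico_add_one_right_eq_Icc]
  refine hsum.trans (add_le_add_left ?_ _)
  exact div_le_div_of_nonneg_right (h.dual_mem hρ.le (by simp)).2 hη.le

theorem violation_le (h : PrimalDualRun f g fh gh e e' φ x B G ρ η T) (hρ : 0 < ρ) (hG : 0 < G)
    (hη : η = ρ / (G * √T)) (hT : 1 ≤ T) {τ : ℝ} (hτ : 0 < τ) (hτρ : 4 * B / τ ≤ ρ)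
    (hslater : ∀ t ∈ Finset.Icc 1 T, ∃ π ∈ stdSimplex ℝ X, policyMean π (g t) ≤ -τ)
    (hgG : ∀ t ∈ Finset.Icc 1 T, g t (x t) ≤ G)
    {w : ℕ → ℝ} (hw : ∀ t ∈ Finset.Icc 1 T, g t (x t) ≤ gh t (x t) + w t)
    (hw0 : ∀ t ∈ Finset.Icc 1 T, 0 ≤ w t) :
    violation g T x ≤ 2 * (G * √T) + ∑ t ∈ Finset.Icc 1 T, (e' t + w t) := by
  have hT0 : (0 : ℝ) < T := by exact_mod_cast hT
  have hs : 0 < √(T : ℝ) := Real.sqrt_pos.2 hT0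
  have hss : √(T : ℝ) * √T = T := Real.mul_self_sqrt hT0.le
  have hsum0 : 0 ≤ ∑ t ∈ Finset.Icc 1 T, (e' t + w t) :=
    Finset.sum_nonneg fun t ht => add_nonneg (h.error_nonneg t ht) (hw0 t ht)
  refine max_le ?_ (by positivity)
  -- for `T < 4` one dual step may exceed `ρ / 2`, but then `T G ≤ 2 G √T` is enough
  rcases le_or_gt 2 √(T : ℝ) with h2 | h2
  · have hηpos : 0 < η := by rw [hη]; positivity
    have hηG : η * G ≤ ρ / 2 := by
      have : η * G = ρ / √T := by rw [hη]; field_simp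
      rw [this]
      exact div_le_div_of_nonneg_left hρ.le two_pos h2
    have h3 := h.sum_constraint_le hρ hηpos hηG hτ hτρ hslater
    have h4 : ρ / η = G * √T := by rw [hη]; field_simp
    have h5 := Finset.sum_le_sum hw
    rw [Finset.sum_add_distrib] at h5 ⊢
    have : 0 < G * √(T : ℝ) := by positivity
    linarith
  · have h3 := Finset.sum_le_sum hgG
    rw [Finset.sum_const, Nat.card_Icc, Nat.add_sub_cancel, nsmul_eq_mul] at h3
    have h4 : (T : ℝ) * G ≤ 2 * (G * √T) := by
      have h5 : (T : ℝ) * G = √T * (G * √T) := by linear_combination -G * hss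
      rw [h5]
      gcongr
    linarith

end PrimalDualRun

end PrimalDual

/-! ### Optimism of the truncated confidence bounds -/

section Estimates

variable {X : Type*} {p : RestartParams} {k : X → X → ℝ}

namespace RestartParams

theorem le_clip_add {b v m u e : ℝ} (hv : |v| ≤ b) (he : 0 ≤ e) (h : v ≤ m + u + e) :
    v ≤ clip (-b) b (m + u) + e := by
  rw [clip]
  have h1 := le_max_right (-b) (min b (m + u))
  rcases min_cases b (m + u) with h2 | h2 <;> linarith [(abs_le.1 hv).2]

theorem clip_le_add {b v m e : ℝ} (hv : |v| ≤ b) (he : 0 ≤ e) (h : m ≤ v + e) :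
    clip (-b) b m ≤ v + e := by
  rw [clip]
  exact max_le (by linarith [(abs_le.1 hv).1]) ((min_le_right _ _).trans h)

variable {x : ℕ → X} {y : ℕ → ℝ} {b : ℝ} {t : ℕ} {z : X} {v e : ℝ}

theorem le_ucb_add (hv : |v| ≤ b) (he : 0 ≤ e)
    (h : |v - p.mean k x y t z| ≤ p.width k b t * p.sd k x t z + e) :
    v ≤ p.ucb k b x y t z + e :=
  le_clip_add hv he (by linarith [(abs_le.1 h).2])

theorem ucb_le_add (hv : |v| ≤ b) (he : 0 ≤ e) (hw : 0 ≤ p.width k b t)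
    (h : |v - p.mean k x y t z| ≤ p.width k b t * p.sd k x t z + e) :
    p.ucb k b x y t z ≤ v + (2 * (p.width k b t * p.sd k x t z) + e) := by
  have : 0 ≤ p.width k b t * p.sd k x t z := mul_nonneg hw (Real.sqrt_nonneg _)
  exact clip_le_add hv (by linarith) (by linarith [(abs_le.1 h).1])

theorem lcb_le_add (hv : |v| ≤ b) (he : 0 ≤ e)
    (h : |v - p.mean k x y t z| ≤ p.width k b t * p.sd k x t z + e) :
    p.lcb k b x y t z ≤ v + e :=
  clip_le_add hv he (by linarith [(abs_le.1 h).1])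

theorem le_lcb_add (hv : |v| ≤ b) (he : 0 ≤ e) (hw : 0 ≤ p.width k b t)
    (h : |v - p.mean k x y t z| ≤ p.width k b t * p.sd k x t z + e) :
    v ≤ p.lcb k b x y t z + (2 * (p.width k b t * p.sd k x t z) + e) := by
  have : 0 ≤ p.width k b t * p.sd k x t z := mul_nonneg hw (Real.sqrt_nonneg _)
  have h1 := (abs_le.1 h).2
  rw [lcb, sub_eq_add_neg]
  exact le_clip_add hv (by linarith) (by linarith)

end RestartParams

end Estimates

/-! ### Summation over restart windows -/

section Budgets

variable {X H : Type*} [NormedAddCommGroup H] [InnerProductSpace ℝ H] [CompleteSpace H]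
  [RKHS ℝ H X ℝ] {p : RestartParams}

namespace RestartParams

/-- Each increment `‖f (i + 1) - f i‖` is charged to at most `p.W - 1` later slots of its window. -/
theorem sum_pathVariation_le {H : Type*} [NormedAddCommGroup H] (f : ℕ → H) (hW : 1 ≤ p.W)
    (T : ℕ) : ∑ t ∈ Finset.Icc 1 T, pathVariation f (p.start t) t ≤
      (p.W - 1 : ℕ) * ∑ i ∈ Finset.Icc 1 (T - 1), ‖f (i + 1) - f i‖ := by
  unfold pathVariation
  rw [Finset.sum_comm' (t' := Finset.Icc 1 (T - 1))
    (s' := fun i => (Finset.Icc 1 T).filter fun t => p.start t ≤ i ∧ i < t), Finset.mul_sum]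
  · refine Finset.sum_le_sum fun i _ => ?_
    rw [Finset.sum_const, nsmul_eq_mul]
    refine mul_le_mul_of_nonneg_right ?_ (norm_nonneg _)
    have : ((Finset.Icc 1 T).filter fun t => p.start t ≤ i ∧ i < t) ⊆
        Finset.Ioc i (i + (p.W - 1)) := fun t ht => by
      simp only [Finset.mem_filter, Finset.mem_Icc, Finset.mem_Ioc] at ht ⊢
      have h1 := start_add_age (p := p) ht.1.1
      have h2 := age_lt (p := p) ht.1.1 hW
      omega
    have := Finset.card_le_card this
    rw [Nat.card_Ioc, Nat.add_sub_cancel_left] at this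
    exact_mod_cast this
  · intro t i
    simp only [Finset.mem_filter, Finset.mem_Icc, Finset.mem_Ico]
    have : 1 ≤ p.start t := Nat.le_add_left _ _
    omega

theorem sum_sd_sq_le [Finite X] [Nonempty X] (hlam : 0 < p.lam)
    (hk1 : ∀ z : X, scalarKernel H z z ≤ 1) (hW : 1 ≤ p.W) {T : ℕ} (hWT : p.W ≤ T) (x : ℕ → X) :
    ∑ t ∈ Finset.Icc 1 T, p.sd (scalarKernel H) x t (x t) ^ 2 ≤
      ⌈(T : ℝ) / p.W⌉₊ * (2 * (1 + p.lam) * infoGain (scalarKernel H (X := X)) p.lam T) := by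
  have hk := scalarKernel_eq_inner (H := H) (X := X)
  have hWr : (0 : ℝ) < p.W := by exact_mod_cast hW
  set F : ℕ → ℝ := fun t => p.sd (scalarKernel H) x t (x t) ^ 2 with hF
  have hblock : ∀ j, ∑ i ∈ Finset.range p.W, F (j * p.W + i + 1) ≤
      2 * (1 + p.lam) * infoGain (scalarKernel H (X := X)) p.lam T := fun j => by
    have h1 := sum_postVar_le hk hlam hk1 (fun i => x (j * p.W + 1 + i)) p.W
    have h2 := infoGain_mono hk hlam hWT
    refine (le_of_eq (Finset.sum_congr rfl fun i hi => ?_)).trans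
      (h1.trans (mul_le_mul_of_nonneg_left h2 (by positivity)))
    have hi := Finset.mem_range.1 hi
    have h3 : p.start (j * p.W + i + 1) = j * p.W + 1 := by
      rw [start, Nat.add_sub_cancel, mul_comm j, Nat.mul_add_div hW, Nat.div_eq_of_lt hi, add_zero,
        mul_comm]
    have h4 : p.age (j * p.W + i + 1) = i := by rw [age, h3]; omega
    have h5 : j * p.W + i + 1 = j * p.W + 1 + i := by ring
    rw [hF]
    simp only [sd]
    rw [Real.sq_sqrt (postVar_nonneg hk hlam _ _), h3, h4, h5]
  have hblocks : ∀ J, ∑ i ∈ Finset.range (J * p.W), F (i + 1) ≤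
      J * (2 * (1 + p.lam) * infoGain (scalarKernel H (X := X)) p.lam T) := fun J => by
    induction J with
    | zero => simp
    | succ J ih =>
      rw [Nat.succ_mul, Finset.sum_range_add, Nat.cast_succ, add_mul, one_mul]
      exact add_le_add ih (hblock J)
  refine le_trans ?_ (hblocks _)
  have h6 : T ≤ ⌈(T : ℝ) / p.W⌉₊ * p.W := by
    have := Nat.le_ceil ((T : ℝ) / p.W)
    rw [div_le_iff₀ hWr] at this
    exact_mod_cast this
  calc ∑ t ∈ Finset.Icc 1 T, F t = ∑ i ∈ Finset.range T, F (i + 1) := by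
        rw [← Finset.Ico_add_one_right_eq_Icc, Finset.sum_Ico_eq_sum_range, Nat.add_sub_cancel]
        simp_rw [add_comm 1]
    _ ≤ _ := Finset.sum_le_sum_of_subset_of_nonneg (Finset.range_subset_range.2 h6)
        fun _ _ _ => sq_nonneg _

theorem sum_sd_le [Finite X] [Nonempty X] (hlam : 0 < p.lam)
    (hk1 : ∀ z : X, scalarKernel H z z ≤ 1) (hW : 1 ≤ p.W) {T : ℕ} (hWT : p.W ≤ T) (x : ℕ → X)
    {w γ : ℝ} (hw : 0 < w) (hwW : w ≤ p.W)
    (hγ : infoGain (scalarKernel H (X := X)) p.lam T ≤ γ) (hγ0 : 0 ≤ γ) :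
    ∑ t ∈ Finset.Icc 1 T, p.sd (scalarKernel H) x t (x t) ≤
      2 * √(1 + p.lam) * (T * √(γ / w)) := by
  have hWr : (0 : ℝ) < p.W := by exact_mod_cast hW
  have hTW : (1 : ℝ) ≤ T / p.W := by
    rw [one_le_div hWr]; exact_mod_cast hWT
  have hceil : (⌈(T : ℝ) / p.W⌉₊ : ℝ) ≤ 2 * (T / w) := by
    have h1 := (Nat.ceil_lt_add_one (zero_le_one.trans hTW)).le
    have h2 : (T : ℝ) / p.W ≤ T / w := by gcongr
    linarith
  have h1 := sum_sd_sq_le hlam hk1 hW hWT x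
  have h2 : (∑ t ∈ Finset.Icc 1 T, p.sd (scalarKernel H) x t (x t)) ^ 2 ≤
      T * (2 * (T / w) * (2 * (1 + p.lam) * γ)) := by
    have h3 := sq_sum_le_card_mul_sum_sq (s := Finset.Icc 1 T)
      (f := fun t => p.sd (scalarKernel H) x t (x t))
    rw [Nat.card_Icc, Nat.add_sub_cancel] at h3
    refine h3.trans (mul_le_mul_of_nonneg_left (h1.trans ?_) (Nat.cast_nonneg _))
    calc _ ≤ (⌈(T : ℝ) / p.W⌉₊ : ℝ) * (2 * (1 + p.lam) * γ) := by gcongr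
      _ ≤ _ := by gcongr
  refine (Real.le_sqrt_of_sq_le h2).trans (le_of_eq ?_)
  rw [Real.sqrt_eq_iff_mul_self_eq (by positivity) (by positivity)]
  have h4 : √(1 + p.lam) * √(1 + p.lam) = 1 + p.lam := Real.mul_self_sqrt (by positivity)
  have h5 : √(γ / w) * √(γ / w) = γ / w := Real.mul_self_sqrt (by positivity)
  symm
  calc _ = 4 * (√(1 + p.lam) * √(1 + p.lam)) * (T * T * (√(γ / w) * √(γ / w))) := by ring
    _ = _ := by rw [h4, h5]; ring

theorem width_nonneg {k : X → X → ℝ} {b : ℝ} (hb : 0 ≤ b) (hR : 0 ≤ p.R) (t : ℕ) :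
    0 ≤ p.width k b t := by
  unfold width; positivity

theorem width_le [Finite X] [Nonempty X] (hlam : 0 < p.lam) (hR : 0 ≤ p.R) {T t : ℕ}
    (ht : t ∈ Finset.Icc 1 T) {b c κ γ : ℝ} (hb : 0 ≤ b) (hc : 0 < c) (hcγ : c ≤ γ)
    (hγ : infoGain (scalarKernel H (X := X)) p.lam T ≤ γ)
    (hδ : Real.log (1 / p.delta) ≤ κ * γ) :
    p.width (scalarKernel H (X := X)) b t ≤
      (b / √c + 1 / √p.lam * p.R * √(2 * κ + 2)) * √γ := by
  have h1 : infoGain (scalarKernel H (X := X)) p.lam (p.age t) ≤ γ :=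
    (infoGain_mono scalarKernel_eq_inner hlam (by
      have := (Finset.mem_Icc.1 ht).2
      unfold age; omega)).trans hγ
  have hγ0 : 0 < γ := hc.trans_le hcγ
  have h2 : √(2 * Real.log (1 / p.delta) + 2 * infoGain (scalarKernel H (X := X)) p.lam (p.age t))
      ≤ √(2 * κ + 2) * √γ := by
    rw [← Real.sqrt_mul' _ hγ0.le]
    exact Real.sqrt_le_sqrt (by nlinarith)
  have h3 : b ≤ b / √c * √γ := by
    have hcs : 0 < √c := Real.sqrt_pos.2 hc
    rw [div_mul_eq_mul_div, le_div_iff₀ hcs]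
    exact mul_le_mul_of_nonneg_left (Real.sqrt_le_sqrt hcγ) hb
  rw [width, add_mul, mul_assoc _ _ √γ]
  gcongr

end RestartParams

/-! ### Orders of growth -/

/-- The common order of growth of the two bounds. -/
noncomputable def growthRate (γ : ℝ) (T : ℕ) (b : ℝ) : ℝ :=
  γ ^ (7 / 8 : ℝ) * b ^ (1 / 4 : ℝ) * (T : ℝ) ^ (3 / 4 : ℝ)

theorem restartPeriod_pos {γ b : ℝ} {T : ℕ} (hγ : 0 < γ) (hb : 0 < b) (hT : 1 ≤ T) :
    0 < restartPeriod γ T b := by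
  have : (0 : ℝ) < T := by exact_mod_cast hT
  unfold restartPeriod; positivity

/-- The estimation error `T γ W^{-1/2}` has the common order of growth. -/
theorem sqrt_mul_sqrt_div_restartPeriod {γ b : ℝ} {T : ℕ} (hγ : 0 < γ) (hb : 0 < b) (hT : 1 ≤ T) :
    √γ * (T * √(γ / restartPeriod γ T b)) = growthRate γ T b := by
  have hT0 : (0 : ℝ) < T := by exact_mod_cast hT
  have hl : ∀ {u v : ℝ}, 0 < u → 0 < v → Real.log u = Real.log v → u = v := fun hu hv h =>
    Real.log_injOn_pos hu hv h
  have hW := restartPeriod_pos hγ hb hT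
  refine hl (by positivity) (by unfold growthRate; positivity) ?_
  rw [Real.log_mul (by positivity) (by positivity), Real.log_mul (by positivity) (by positivity),
    Real.log_sqrt hγ.le, Real.log_sqrt (by positivity), Real.log_div hγ.ne' hW.ne']
  unfold growthRate restartPeriod
  rw [Real.log_mul (by positivity) (by positivity), Real.log_mul (by positivity) (by positivity),
    Real.log_mul (by positivity) (by positivity), Real.log_mul (by positivity) (by positivity),
    Real.log_rpow hγ, Real.log_rpow hγ, Real.log_rpow hb, Real.log_rpow hb, Real.log_rpow hT0,
    Real.log_rpow hT0]
  ring

/-- The drift error `W^{3/2} b` has the common order of growth; the information gain is bounded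
below, so its missing power `1 / 2` costs a constant. -/
theorem sqrt_mul_restartPeriod_mul_le {γ b c lam : ℝ} {T : ℕ} (hlam : 0 < lam) (hc : 0 < c)
    (hcγ : c ≤ γ) (hb : 0 < b) (hT : 1 ≤ T) :
    √(restartPeriod γ T b / lam) * (restartPeriod γ T b * b) ≤
      1 / (√lam * √c) * growthRate γ T b := by
  have hT0 : (0 : ℝ) < T := by exact_mod_cast hT
  have hγ : 0 < γ := hc.trans_le hcγ
  have hW := restartPeriod_pos hγ hb hT
  have h1 : √(restartPeriod γ T b) * (restartPeriod γ T b * b) * √γ = growthRate γ T b := by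
    refine Real.log_injOn_pos (Set.mem_Ioi.2 (by positivity))
      (Set.mem_Ioi.2 (by unfold growthRate; positivity)) ?_
    rw [Real.log_mul (by positivity) (by positivity), Real.log_mul (by positivity) (by positivity),
      Real.log_mul (by positivity) (by positivity), Real.log_sqrt hγ.le, Real.log_sqrt hW.le]
    unfold growthRate restartPeriod
    rw [Real.log_mul (by positivity) (by positivity), Real.log_mul (by positivity) (by positivity),
      Real.log_mul (by positivity) (by positivity), Real.log_mul (by positivity) (by positivity),
      Real.log_rpow hγ, Real.log_rpow hγ, Real.log_rpow hb, Real.log_rpow hb, Real.log_rpow hT0,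
      Real.log_rpow hT0]
    ring
  have hcs : 0 < √c := Real.sqrt_pos.2 hc
  have hls : 0 < √lam := Real.sqrt_pos.2 hlam
  rw [← h1, Real.sqrt_div hW.le, one_div_mul_eq_div, le_div_iff₀ (by positivity)]
  calc _ = √(restartPeriod γ T b) * (restartPeriod γ T b * b) * √c := by field_simp
    _ ≤ _ := by gcongr

namespace RestartParams

theorem sum_drift_le {H : Type*} [NormedAddCommGroup H] {f : ℕ → H} {T : ℕ} {γ b c : ℝ} (hlam : 0 < p.lam) (hc : 0 < c)
    (hcγ : c ≤ γ) (hb : 0 < b) (hT : 1 ≤ T) (hW : p.W = ⌈restartPeriod γ T b⌉₊)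
    (hf : ∑ i ∈ Finset.Icc 1 (T - 1), ‖f (i + 1) - f i‖ ≤ b) :
    ∑ t ∈ Finset.Icc 1 T, √(p.age t / p.lam) * pathVariation f (p.start t) t ≤
      1 / (√p.lam * √c) * growthRate γ T b := by
  have hw := restartPeriod_pos (hc.trans_le hcγ) hb hT
  have hW1 : 1 ≤ p.W := by rw [hW]; exact Nat.one_le_iff_ne_zero.2 (Nat.ceil_pos.2 hw).ne'
  have hWle : ((p.W - 1 : ℕ) : ℝ) ≤ restartPeriod γ T b := by
    rw [Nat.cast_sub hW1, hW]
    have := Nat.ceil_lt_add_one hw.le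
    push_cast
    linarith
  refine le_trans ?_ (sqrt_mul_restartPeriod_mul_le hlam hc hcγ hb hT)
  calc _ ≤ ∑ t ∈ Finset.Icc 1 T, √(restartPeriod γ T b / p.lam) *
        pathVariation f (p.start t) t := by
        refine Finset.sum_le_sum fun t ht => mul_le_mul_of_nonneg_right
          (Real.sqrt_le_sqrt (div_le_div_of_nonneg_right ?_ hlam.le)) (pathVariation_nonneg _ _ _)
        have h1 := age_lt (p := p) (Finset.mem_Icc.1 ht).1 hW1
        have h2 : p.age t ≤ p.W - 1 := by omega
        exact le_trans (by exact_mod_cast h2) hWle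
    _ ≤ _ := by
        rw [← Finset.mul_sum]
        refine mul_le_mul_of_nonneg_left ((sum_pathVariation_le f hW1 T).trans ?_)
          (Real.sqrt_nonneg _)
        exact mul_le_mul hWle hf (Finset.sum_nonneg fun _ _ => norm_nonneg _) hw.le

theorem sum_width_mul_sd_le [Finite X] [Nonempty X] {T : ℕ} {γ b c κ B : ℝ} (hlam : 0 < p.lam)
    (hR : 0 ≤ p.R) (hB : 0 ≤ B) (hc : 0 < c) (hcγ : c ≤ γ) (hb : 0 < b) (hT : 1 ≤ T)
    (hW : p.W = ⌈restartPeriod γ T b⌉₊) (hWT : restartPeriod γ T b ≤ T)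
    (hk1 : ∀ z : X, scalarKernel H z z ≤ 1)
    (hγ : infoGain (scalarKernel H (X := X)) p.lam T ≤ γ)
    (hδ : Real.log (1 / p.delta) ≤ κ * γ) (x : ℕ → X) :
    ∑ t ∈ Finset.Icc 1 T, p.width (scalarKernel H) B t * p.sd (scalarKernel H) x t (x t) ≤
      (B / √c + 1 / √p.lam * p.R * √(2 * κ + 2)) * (2 * √(1 + p.lam)) * growthRate γ T b := by
  have hγ0 := hc.trans_le hcγ
  have hw := restartPeriod_pos hγ0 hb hT
  have hW1 : 1 ≤ p.W := by rw [hW]; exact Nat.one_le_iff_ne_zero.2 (Nat.ceil_pos.2 hw).ne'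
  have h1 := sum_sd_le hlam hk1 hW1 (by rw [hW]; exact Nat.ceil_le.2 hWT) x hw
    (by rw [hW]; exact Nat.le_ceil _) hγ hγ0.le
  calc _ ≤ ∑ t ∈ Finset.Icc 1 T, (B / √c + 1 / √p.lam * p.R * √(2 * κ + 2)) * √γ *
        p.sd (scalarKernel H) x t (x t) :=
        Finset.sum_le_sum fun t ht => mul_le_mul_of_nonneg_right
          (width_le hlam hR ht hB hc hcγ hγ hδ) (Real.sqrt_nonneg _)
    _ ≤ (B / √c + 1 / √p.lam * p.R * √(2 * κ + 2)) * √γ *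
        (2 * √(1 + p.lam) * (T * √(γ / restartPeriod γ T b))) := by
        rw [← Finset.mul_sum]
        exact mul_le_mul_of_nonneg_left h1 (by positivity)
    _ = _ := by
        rw [← sqrt_mul_sqrt_div_restartPeriod hγ0 hb hT]
        ring

end RestartParams

end Budgets

section LogHorizon

variable {X : Type*}

/-- Repeated sampling of the point where `γ₁` is attained shows that `log T` is at most of the order
of `γ_T`. This is where the lower bound on `γ₁` enters. -/
theorem log_mul_exp_sub_one_le_infoGain [Finite X] [Nonempty X] {k : X → X → ℝ} {lam c : ℝ}
    (hlam : 0 < lam) (hk0 : ∀ z, 0 ≤ k z z) (hc : 0 < c) (hck : c ≤ infoGain k lam 1)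
    {T : ℕ} (hT : 1 ≤ T) :
    Real.log (T * (Real.exp (2 * c) - 1)) ≤ 2 * infoGain k lam T := by
  obtain ⟨z, hz⟩ := infoGain_one k lam
  have hT0 : (0 : ℝ) < T := by exact_mod_cast hT
  have h0 : 0 ≤ lam⁻¹ * k z z := mul_nonneg (inv_nonneg.2 hlam.le) (hk0 z)
  have h1 : Real.exp (2 * c) ≤ 1 + lam⁻¹ * k z z := by
    rw [← Real.le_log_iff_exp_le (by linarith)]
    linarith
  have h2 : 0 < Real.exp (2 * c) - 1 := by
    linarith [Real.add_one_le_exp (2 * c)]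
  have h3 := half_log_one_add_le_infoGain k lam T z
  have h4 : Real.log (T * (Real.exp (2 * c) - 1)) ≤ Real.log (1 + T * (lam⁻¹ * k z z)) :=
    Real.log_le_log (by positivity) (by nlinarith)
  linarith

theorem log_one_div_le {δ q a γ c : ℝ} {T : ℕ} (hT : 1 ≤ T) (hq : 0 < q) (ha : 0 < a)
    (hc : 0 < c) (hcγ : c ≤ γ) (hδ : q / T ≤ δ) (h : Real.log (T * a) ≤ 2 * γ) :
    Real.log (1 / δ) ≤ (2 + |Real.log (1 / (a * q))| / c) * γ := by
  have hT0 : (0 : ℝ) < T := by exact_mod_cast hT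
  have hδ0 : 0 < δ := lt_of_lt_of_le (by positivity) hδ
  have h1 : Real.log (1 / δ) ≤ Real.log (T * a * (1 / (a * q))) := by
    refine Real.log_le_log (by positivity) ?_
    have : (T : ℝ) * a * (1 / (a * q)) = 1 / (q / T) := by field_simp
    rw [this]
    exact one_div_le_one_div_of_le (by positivity) hδ
  rw [Real.log_mul (by positivity) (by positivity)] at h1
  have h2 : |Real.log (1 / (a * q))| ≤ |Real.log (1 / (a * q))| / c * γ := by
    rw [div_mul_eq_mul_div, le_div_iff₀ hc]
    exact mul_le_mul_of_nonneg_left hcγ (abs_nonneg _)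
  linarith [le_abs_self (Real.log (1 / (a * q)))]

end LogHorizon

/-! ### Regret and constraint violation -/

section Run

variable {X H H' : Type*} [NormedAddCommGroup H] [InnerProductSpace ℝ H]
  [CompleteSpace H] [RKHS ℝ H X ℝ] [NormedAddCommGroup H'] [InnerProductSpace ℝ H']
  [CompleteSpace H'] [RKHS ℝ H' X ℝ] {p : RestartParams}

namespace RestartParams

/-- A trajectory whose confidence bounds for the constraint and the reward hold up to the drift in
each window is a run of the primal-dual iteration with the drifts as optimism errors. -/
theorem IsTrajectory.primalDualRun {f : ℕ → H} {g : ℕ → H'} {B G : ℝ} {T : ℕ} {x : ℕ → X}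
    {r c : ℕ → ℝ} {e e' : ℕ → ℝ}
    (h : p.IsTrajectory (scalarKernel H) (scalarKernel H') B G T x r c)
    (hB : 0 ≤ B) (hG : 0 ≤ G) (hf : ∀ t ∈ Finset.Icc 1 T, ∀ z, |f t z| ≤ B)
    (hg : ∀ t ∈ Finset.Icc 1 T, ∀ z, |g t z| ≤ G) (he : ∀ t, 0 ≤ e t) (he' : ∀ t, 0 ≤ e' t)
    (hcf : ∀ t ∈ Finset.Icc 1 T, ∀ z, |f t z - p.mean (scalarKernel H) x r t z| ≤
      p.width (scalarKernel H) B t * p.sd (scalarKernel H) x t z + e t)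
    (hcg : ∀ t ∈ Finset.Icc 1 T, ∀ z, |g t z - p.mean (scalarKernel H') x c t z| ≤
      p.width (scalarKernel H') G t * p.sd (scalarKernel H') x t z + e' t) :
    PrimalDualRun (fun t => f t) (fun t => g t) (p.ucb (scalarKernel H) B x r)
      (p.lcb (scalarKernel H') G x c) e e' (p.dual (scalarKernel H') G x c) x B G p.rho p.eta T where
  reward_mem _ _ _ := ⟨le_clip _ _ _, clip_le (by linarith)⟩
  constraint_mem _ _ _ := ⟨le_clip _ _ _, clip_le (by linarith)⟩
  reward_optimistic t ht z := le_ucb_add (hf t ht z) (he t) (hcf t ht z)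
  constraint_optimistic t ht z := lcb_le_add (hg t ht z) (he' t) (hcg t ht z)
  error_nonneg t _ := he' t
  dual_one := rfl
  dual_succ t ht := by
    obtain ⟨s, rfl⟩ := Nat.exists_eq_add_of_le' (Finset.mem_Icc.1 ht).1
    rfl
  maximizes := h

end RestartParams

end Run

/-- Constant in front of the growth rate in the sum of the confidence widths. -/
noncomputable def widthConst (B R lam c κ : ℝ) : ℝ :=
  (B / √c + 1 / √lam * R * √(2 * κ + 2)) * (2 * √(1 + lam))

theorem widthConst_nonneg {B R : ℝ} (hB : 0 ≤ B) (hR : 0 ≤ R) (lam c κ : ℝ) :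
    0 ≤ widthConst B R lam c κ := by
  unfold widthConst; positivity

theorem corollary1 :
    -- an absolute constant
    ∃ C₀ : ℝ,
    ∀ B G R lam c q : ℝ, 0 < B → 0 < G → 0 ≤ R → 0 < lam → 0 < c → 0 < q →
    -- a constant depending on `B`, `G`, `R`, `lam`, `c`, `q` only
    ∃ C : ℝ,
    ∀ (X : Type*) [Fintype X]
      -- the two reproducing kernel Hilbert spaces of functions on `X`
      (H : Type*) [NormedAddCommGroup H] [InnerProductSpace ℝ H] [CompleteSpace H]
      [RKHS ℝ H X ℝ]
      (H' : Type*) [NormedAddCommGroup H'] [InnerProductSpace ℝ H'] [CompleteSpace H']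
      [RKHS ℝ H' X ℝ]
      (f : ℕ → H) (g : ℕ → H') (T : ℕ) (τ Bf Bg ρ δ : ℝ) (πs : ℕ → X → ℝ)
      (Ω : Type*) (mΩ : MeasurableSpace Ω) (P : Measure Ω) [IsProbabilityMeasure P]
      (ℱ : Filtration ℕ mΩ) (n ε : ℕ → Ω → ℝ) (x : ℕ → Ω → X),
    1 ≤ T →
    -- boundedness
    (∀ z : X, scalarKernel H z z ≤ 1) → (∀ z : X, scalarKernel H' z z ≤ 1) →
    (∀ t ∈ Finset.Icc 1 T, ‖f t‖ ≤ B) → (∀ t ∈ Finset.Icc 1 T, ‖g t‖ ≤ G) →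
    -- Slater condition
    0 < τ →
    (∀ t ∈ Finset.Icc 1 T, ∃ π ∈ stdSimplex ℝ X, policyMean π (g t) ≤ -τ) →
    -- variation budgets
    ∑ t ∈ Finset.Icc 1 (T - 1), ‖f (t + 1) - f t‖ ≤ Bf →
    ∑ t ∈ Finset.Icc 1 (T - 1), ‖g (t + 1) - g t‖ ≤ Bg →
    -- the benchmark policies
    (∀ t ∈ Finset.Icc 1 T, IsBestPolicy (f t) (g t) (πs t)) →
    -- the noise
    IsNoise ℱ P R T n → IsNoise ℱ P R T ε →
    -- the algorithm's parameters
    4 * B / τ ≤ ρ → q / T ≤ δ → δ < 1 →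
    ∀ (γ : ℕ → ℝ) (b W : ℝ) (p : RestartParams),
    -- combined information gain, combined variation budget, restart period (used rounded up)
    γ = combinedGain (scalarKernel H) (scalarKernel H') lam →
    b = max Bf Bg → 0 < b →
    W = restartPeriod (γ T) T b →
    p = { lam := lam, R := R, delta := δ, W := ⌈W⌉₊, rho := ρ, eta := ρ / (G * √T) } →
    -- the Slater condition forces `0 < γ 1`, so that some `c` always applies
    c ≤ γ 1 → W ≤ T →
    -- `x` is chosen by the algorithm from the past observations
    (∀ t ∈ Finset.Icc 1 T, ∀ z : X, MeasurableSet[ℱ (t - 1)] {ω | x t ω = z}) →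
    (∀ ω, p.IsTrajectory (scalarKernel H) (scalarKernel H') B G T (fun t => x t ω)
      (fun t => f t (x t ω) + n t ω) (fun t => g t (x t ω) + ε t ω)) →
    1 - 2 * (⌈(T : ℝ) / ⌈W⌉₊⌉₊ : ℝ) * δ ≤ P.real {ω |
      dynRegret (fun t => f t) πs T (fun t => x t ω) ≤
        C₀ * (ρ * G * √T) +
          C * (ρ * γ T ^ (7 / 8 : ℝ) * b ^ (1 / 4 : ℝ) * (T : ℝ) ^ (3 / 4 : ℝ)) ∧
      violation (fun t => g t) T (fun t => x t ω) ≤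
        C * ((1 + 1 / ρ) * γ T ^ (7 / 8 : ℝ) * b ^ (1 / 4 : ℝ) *
          (T : ℝ) ^ (3 / 4 : ℝ)) + C₀ * (G * √T)} := by
  refine ⟨2, fun B G R lam c q hB hG hR hlam hc hq => ?_⟩
  set κ : ℝ := 2 + |Real.log (1 / ((Real.exp (2 * c) - 1) * q))| / c with hκ
  set A : ℝ := 1 / (√lam * √c) with hA
  set Kf : ℝ := widthConst B R lam c κ with hKf
  set Kg : ℝ := widthConst G R lam c κ with hKg
  have hA0 : 0 ≤ A := by positivity
  have hKf0 : 0 ≤ Kf := widthConst_nonneg hB.le hR _ _ _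
  have hKg0 : 0 ≤ Kg := widthConst_nonneg hG.le hR _ _ _
  refine ⟨A + (2 * A + 2 * Kf) * (G / (4 * B)) + (2 * A + 2 * Kg), ?_⟩
  intro X _ H _ _ _ _ H' _ _ _ _ f g T τ Bf Bg ρ δ πs Ω mΩ P _ ℱ n ε x hT hk1 hk1' hf hg hτ hslater
    hBf hBg hπs hn hε hρτ hqδ hδ1 γ b W p hγ hb hb0 hW hp hcγ1 hWT hx htraj
  have hT0 : (0 : ℝ) < T := by exact_mod_cast hT
  have hTmem : 1 ∈ Finset.Icc 1 T := Finset.mem_Icc.2 ⟨le_rfl, hT⟩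
  have hρ : 0 < ρ := lt_of_lt_of_le (by positivity) hρτ
  have hδ0 : 0 < δ := lt_of_lt_of_le (by positivity) hqδ
  -- a probability distribution exists only on a nonempty set
  obtain ⟨π₁, hπ₁, hπ₁g⟩ := hslater 1 hTmem
  have : Nonempty X := by
    by_contra hX
    rw [not_nonempty_iff] at hX
    simpa using hπ₁.2
  have hfB : ∀ t ∈ Finset.Icc 1 T, ∀ z, |f t z| ≤ B := fun t ht z =>
    (abs_apply_le_norm hk1 _ z).trans (hf t ht)
  have hgG : ∀ t ∈ Finset.Icc 1 T, ∀ z, |g t z| ≤ G := fun t ht z =>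
    (abs_apply_le_norm hk1' _ z).trans (hg t ht)
  -- the Slater condition forces `τ ≤ G`, so that `ρ` is bounded below by `4 B / G`
  have hτG : τ ≤ G := by
    have h1 := policyMean_mono hπ₁ fun z => (abs_le.1 (hgG 1 hTmem z)).1
    rw [policyMean_const hπ₁] at h1
    linarith
  have hρB : 1 ≤ ρ * (G / (4 * B)) := by
    rw [div_le_iff₀ hτ] at hρτ
    rw [← mul_div_assoc, le_div_iff₀ (by positivity)]
    nlinarith
  have hkH := scalarKernel_eq_inner (H := H) (X := X)
  have hkH' := scalarKernel_eq_inner (H := H') (X := X)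
  have hγf : infoGain (scalarKernel H (X := X)) lam T ≤ γ T := by rw [hγ]; exact le_max_left _ _
  have hγg : infoGain (scalarKernel H' (X := X)) lam T ≤ γ T := by rw [hγ]; exact le_max_right _ _
  have hcγ : c ≤ γ T := by
    refine hcγ1.trans ?_
    rw [hγ]
    exact max_le_max (infoGain_mono hkH hlam hT) (infoGain_mono hkH' hlam hT)
  have ha : 0 < Real.exp (2 * c) - 1 := by linarith [Real.add_one_le_exp (2 * c)]
  have hlogδ : Real.log (1 / δ) ≤ κ * γ T := by
    refine log_one_div_le hT hq ha hc hcγ hqδ ?_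
    have hk0 : ∀ z : X, 0 ≤ scalarKernel H z z := fun z => by
      rw [hkH]; exact real_inner_self_nonneg
    have hk0' : ∀ z : X, 0 ≤ scalarKernel H' z z := fun z => by
      rw [hkH']; exact real_inner_self_nonneg
    rw [hγ] at hcγ1
    rcases le_max_iff.1 hcγ1 with h1 | h1
    · linarith [log_mul_exp_sub_one_le_infoGain hlam hk0 hc h1 hT]
    · linarith [log_mul_exp_sub_one_le_infoGain hlam hk0' hc h1 hT]
  have hplam : p.lam = lam := by rw [hp]
  have hpR : p.R = R := by rw [hp]
  have hpδ : p.delta = δ := by rw [hp]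
  have hpW : p.W = ⌈W⌉₊ := by rw [hp]
  have hpρ : p.rho = ρ := by rw [hp]
  have hpη : p.eta = ρ / (G * √T) := by rw [hp]
  have hW0 : 0 < W := by rw [hW]; exact restartPeriod_pos (hc.trans_le hcγ) hb0 hT
  have hpW1 : 1 ≤ p.W := by rw [hpW]; exact Nat.one_le_iff_ne_zero.2 (Nat.ceil_pos.2 hW0).ne'
  clear hp
  subst hplam hpR hpδ hpρ
  subst hW
  rw [← hpW]
  -- the two events of failure of a confidence bound
  have hbadf := RestartParams.measure_not_confident_le hlam hR hδ0 hpW1 hk1 hf hn hx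
  have hbadg := RestartParams.measure_not_confident_le hlam hR hδ0 hpW1 hk1' hg hε hx
  set badf := {ω | ∃ t ∈ Finset.Icc 1 T, ∃ z, p.width (scalarKernel H) B t *
          p.sd (scalarKernel H) (fun i => x i ω) t z +
          √(p.age t / p.lam) * pathVariation f (p.start t) t <
        |f t z - p.mean (scalarKernel H) (fun i => x i ω)
          (fun i => f i (x i ω) + n i ω) t z|} with hbadf_def
  set badg := {ω | ∃ t ∈ Finset.Icc 1 T, ∃ z, p.width (scalarKernel H') G t *
          p.sd (scalarKernel H') (fun i => x i ω) t z +
          √(p.age t / p.lam) * pathVariation g (p.start t) t <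
        |g t z - p.mean (scalarKernel H') (fun i => x i ω)
          (fun i => g i (x i ω) + ε i ω) t z|} with hbadg_def
  set J : ℕ := ⌈(T : ℝ) / p.W⌉₊
  have hunion : P.real (badf ∪ badg) ≤ 2 * J * p.delta := by
    have h1 : P.real badf ≤ J * p.delta :=
      ENNReal.toReal_le_of_le_ofReal (by positivity) hbadf
    have h2 : P.real badg ≤ J * p.delta :=
      ENNReal.toReal_le_of_le_ofReal (by positivity) hbadg
    linarith [measureReal_union_le (μ := P) badf badg]
  refine le_trans (b := 1 - P.real (badf ∪ badg)) (by linarith) ?_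
  -- the target event need not be measurable, so only subadditivity is used
  have hcover : ∀ S : Set Ω, (badf ∪ badg)ᶜ ⊆ S → 1 - P.real (badf ∪ badg) ≤ P.real S :=
    fun S hS => by
      have h1 : P.real Set.univ ≤ P.real ((badf ∪ badg) ∪ S) :=
        measureReal_mono fun ω _ => by
          by_cases h : ω ∈ badf ∪ badg
          · exact Or.inl h
          · exact Or.inr (hS h)
      rw [probReal_univ] at h1
      linarith [measureReal_union_le (μ := P) (badf ∪ badg) S]
  refine hcover _ fun ω hω => ?_
  rw [Set.mem_compl_iff, Set.mem_union, not_or] at hω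
  obtain ⟨hωf, hωg⟩ := hω
  simp only [hbadf_def, hbadg_def, Set.mem_ofPred_eq, not_exists, not_and, not_lt] at hωf hωg
  have he : ∀ t, 0 ≤ √(p.age t / p.lam) * pathVariation f (p.start t) t := fun t =>
    mul_nonneg (Real.sqrt_nonneg _) (pathVariation_nonneg _ _ _)
  have he' : ∀ t, 0 ≤ √(p.age t / p.lam) * pathVariation g (p.start t) t := fun t =>
    mul_nonneg (Real.sqrt_nonneg _) (pathVariation_nonneg _ _ _)
  have hrun := (htraj ω).primalDualRun hB.le hG.le hfB hgG he he' hωf hωg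
  have hη : 0 < p.eta := by rw [hpη]; positivity
  have hreg := hrun.regret_le hρ.le hη
    (fun t ht => RestartParams.ucb_le_add (hfB t ht _) (he t) (RestartParams.width_nonneg hB.le hR t) (hωf t ht _))
    (fun t ht => (hπs t ht).1.1) (fun t ht => (hπs t ht).1.2)
  have hwg0 : ∀ t, 0 ≤ p.width (scalarKernel H') G t *
      p.sd (scalarKernel H') (fun i => x i ω) t (x t ω) := fun t =>
    mul_nonneg (RestartParams.width_nonneg hG.le hR t) (Real.sqrt_nonneg _)
  have hvio := hrun.violation_le hρ hG hpη hT hτ hρτ hslater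
    (fun t ht => (abs_le.1 (hgG t ht _)).2)
    (fun t ht => RestartParams.le_lcb_add (hgG t ht _) (he' t) (RestartParams.width_nonneg hG.le hR t) (hωg t ht _))
    (fun t _ => by linarith [hwg0 t, he' t])
  have hdf := RestartParams.sum_drift_le hlam hc hcγ hb0 hT hpW (hBf.trans (by rw [hb]; exact le_max_left _ _))
  have hdg := RestartParams.sum_drift_le hlam hc hcγ hb0 hT hpW (hBg.trans (by rw [hb]; exact le_max_right _ _))
  have hwf := RestartParams.sum_width_mul_sd_le hlam hR hB.le hc hcγ hb0 hT hpW hWT hk1 hγf hlogδ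
    (fun t => x t ω)
  have hwg := RestartParams.sum_width_mul_sd_le hlam hR hG.le hc hcγ hb0 hT hpW hWT hk1' hγg hlogδ
    (fun t => x t ω)
  rw [← widthConst, ← hKf] at hwf
  rw [← widthConst, ← hKg] at hwg
  rw [← hA] at hdf hdg
  have hγT : 0 < γ T := hc.trans_le hcγ
  have hΓ0 : 0 ≤ growthRate (γ T) T b := by unfold growthRate; positivity
  have hΓρ : p.rho * γ T ^ (7 / 8 : ℝ) * b ^ (1 / 4 : ℝ) * (T : ℝ) ^ (3 / 4 : ℝ) =
      p.rho * growthRate (γ T) T b := by unfold growthRate; ring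
  have hΓ1 : (1 + 1 / p.rho) * γ T ^ (7 / 8 : ℝ) * b ^ (1 / 4 : ℝ) * (T : ℝ) ^ (3 / 4 : ℝ) =
      (1 + 1 / p.rho) * growthRate (γ T) T b := by unfold growthRate; ring
  simp only [Finset.sum_add_distrib, ← Finset.mul_sum] at hreg hvio
  set Γ := growthRate (γ T) T b
  refine ⟨?_, ?_⟩
  · rw [hΓρ]
    have h1 : (T : ℝ) * (p.eta * G ^ 2 / 2) ≤ 2 * (p.rho * G * √T) := by
      have h2 : √(T : ℝ) * √T = T := Real.mul_self_sqrt hT0.le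
      have h3 : p.rho * G * √T / 2 = T * (p.eta * G ^ 2 / 2) := by
        rw [hpη]
        field_simp
        linear_combination h2
      have : 0 ≤ p.rho * G * √T := by positivity
      linarith
    have h4 := mul_le_mul_of_nonneg_left hdg hρ.le
    have h5 : (2 * A + 2 * Kf) * Γ ≤ (2 * A + 2 * Kf) * Γ * (p.rho * (G / (4 * B))) :=
      le_mul_of_one_le_right (by positivity) hρB
    have h6 : 0 ≤ (2 * A + 2 * Kg) * (p.rho * Γ) := by positivity
    linarith
  · rw [hΓ1]
    have h1 : (2 * A + 2 * Kg) * Γ ≤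
        (A + (2 * A + 2 * Kf) * (G / (4 * B)) + (2 * A + 2 * Kg)) * ((1 + 1 / p.rho) * Γ) := by
      refine mul_le_mul (le_add_of_nonneg_left (by positivity)) ?_ hΓ0 (by positivity)
      exact le_mul_of_one_le_left hΓ0 (by linarith [show 0 < 1 / p.rho by positivity])
    linarith
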